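/- **Proposition A.1** (list-decodable mean estimation when $\alpha^{-1}=\Omega(d)$). Let $d,n\ge 1$, let $T=\{X_1,\dots,X_n\}$ be points of $\mathbb{R}^d$ (repetitions allowed), $\alpha\in(0,\tfrac12]$ and $\mu^*\in\mathbb{R}^d$, and suppose that there is $S\subseteq[n]$ with $|S|\ge\alpha n$ and $$\frac1{|S|}\sum_{i\in S}(X_i-\mu^*)(X_i-\mu^*)^\top\preceq \mathbf I .$$ Let $\delta\in(0,1)$. The algorithm $\mathsf{SamplePostProcess}$, with a constant parameter $K\in\mathbb N$, does the following. 1. Set $N=\lceil 36\log(2/\delta)/\alpha\rceil$ and draw $\widetilde X_1,\dots,\widetilde X_N$ independently and uniformly from $T$. 2. Set $c=\lceil K\log(1/(\alpha\delta))\rceil$ and draw $\mathbf G\in\mathbb{R}^{d\times c}$ with independent entries, uniform on $\{\pm 1/\sqrt c\}$. 3. Greedily compute and return a maximal set $L\subseteq[N]$ (standing for the points $\widetilde X_i$, $i\in L$) such that for each $i\in L$: $\|\mathbf G^\top(\widetilde X_i-\widetilde X_j)\|_2^2\le 8.8\,d$ for at least $\alpha N/3$ of the $j\in[N]$, and $\|\mathbf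 G^\top(\widetilde X_i-\widetilde X_j)\|_2^2> 35.2\,d$ for all $j\in L$, $j\neq i$. There is a universal constant $K_0$ such that for every constant $C>0$ there is a constant $A$ depending only on $C$, and for every $K\ge K_0$ a constant $B$ depending only on $C$ and $K$, such that whenever $\alpha\le\frac1{Cd}$: * in every execution the algorithm returns a maximal set as in step 3, every such maximal set $L$ satisfies $|L|\le 3/\alpha$, and the number of steps executed on a real RAM (unit-cost real arithmetic, comparison, square root, logarithm, rounding up, reading of an input coordinate, uniform sampling of an index in $[n]$, and coin flips) is at most $$B\cdot\frac{1}{\alpha^2}\log^4\!\Big(\frac1{\alpha\delta}\Big);$$ * with probability at least $1-\delta$ over the random choices of steps 1 and 2, every maximal set $L$ as in step 3 (in particular the returned one) satisfies $$\min_{i\in L}\|\widetilde X_i-\mu^*\|_2\le \frac{A}{\sqrt\alpha}.$$ -/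

import Mathlib

/-! ## Randomised real RAM programs with unit-cost instructions -/

/-- Binary arithmetic instructions on real registers. -/
inductive BinOp where
  | add
  | sub
  | mul
  | div

/-- Unary instructions on real registers. -/
inductive UnOp where
  | sqrt
  | log

/-- Programs of a randomised real RAM, as instruction trees. `R` is the type of register contents,
the input is an array of `n` points with `d` coordinates each, and `A` is the type of the result.
A program is written for an arbitrary type `R`, so it can handle register contents only through
the instructions below; its continuation `k` receives the result of the instruction. -/
inductive Prog (R : Type) (n d : ℕ) (A : Type) : Type where
  /-- Halt with a result (free of charge). -/
  | ret (a : A) : Prog R n d A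
  /-- One step of control or bookkeeping: an iteration of a loop, a write to a Boolean array. -/
  | step (k : Unit → Prog R n d A) : Prog R n d A
  /-- Load a rational constant. -/
  | const (q : ℚ) (k : R → Prog R n d A) : Prog R n d A
  /-- Convert an integer (an input size or a loop bound) to a real register. -/
  | ofNat (m : ℕ) (k : R → Prog R n d A) : Prog R n d A
  /-- Binary arithmetic. -/
  | bin (o : BinOp) (x y : R) (k : R → Prog R n d A) : Prog R n d A
  /-- Square root or natural logarithm. -/
  | un (o : UnOp) (x : R) (k : R → Prog R n d A) : Prog R n d A
  /-- The comparison `x ≤ y`. -/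
  | le (x y : R) (k : Bool → Prog R n d A) : Prog R n d A
  /-- Round up to a natural number (to be used as a loop bound). -/
  | ceil (x : R) (k : ℕ → Prog R n d A) : Prog R n d A
  /-- Read coordinate `j` of input point `i`. -/
  | read (i : Fin n) (j : Fin d) (k : R → Prog R n d A) : Prog R n d A
  /-- Draw a fresh uniformly random index of an input point. -/
  | sample (k : Fin n → Prog R n d A) : Prog R n d A
  /-- Flip a fresh fair coin. -/
  | coin (k : Bool → Prog R n d A) : Prog R n d A

namespace Prog

variable {R : Type} {n d : ℕ} {A B : Type}

/-- Sequential composition. -/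
def bind : Prog R n d A → (A → Prog R n d B) → Prog R n d B
  | ret a, f => f a
  | step k, f => step fun u => (k u).bind f
  | const q k, f => const q fun x => (k x).bind f
  | ofNat m k, f => ofNat m fun x => (k x).bind f
  | bin o x y k, f => bin o x y fun z => (k z).bind f
  | un o x k, f => un o x fun z => (k z).bind f
  | le x y k, f => le x y fun b => (k b).bind f
  | ceil x k, f => ceil x fun m => (k m).bind f
  | read i j k, f => read i j fun x => (k x).bind f
  | sample k, f => sample fun i => (k i).bind f
  | coin k, f => coin fun b => (k b).bind f

instance instMonad : Monad (Prog R n d) where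
  pure := ret
  bind := bind

end Prog

/-- The value of a binary instruction. -/
noncomputable def BinOp.eval : BinOp → ℝ → ℝ → ℝ
  | add, x, y => x + y
  | sub, x, y => x - y
  | mul, x, y => x * y
  | div, x, y => x / y

/-- The value of a unary instruction. -/
noncomputable def UnOp.eval : UnOp → ℝ → ℝ
  | sqrt, x => Real.sqrt x
  | log, x => Real.log x

/-- Charge one step. -/
noncomputable def chargeStep {A : Type} (p : PMF (A × ℕ)) : PMF (A × ℕ) :=
  p.map fun o => (o.1, o.2 + 1)

open Classical in
/-- Execution of a program on the input points `X`: the joint law of the result and of the number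
of executed instructions. Every instruction costs one step. -/
noncomputable def Prog.exec {n d : ℕ} [NeZero n] {A : Type}
    (X : Fin n → EuclideanSpace ℝ (Fin d)) : Prog ℝ n d A → PMF (A × ℕ)
  | ret a => PMF.pure (a, 0)
  | step k => chargeStep ((k ()).exec X)
  | const q k => chargeStep ((k (q : ℝ)).exec X)
  | ofNat m k => chargeStep ((k (m : ℝ)).exec X)
  | bin o x y k => chargeStep ((k (o.eval x y)).exec X)
  | un o x k => chargeStep ((k (o.eval x)).exec X)
  | le x y k => chargeStep ((k (decide (x ≤ y))).exec X)
  | ceil x k => chargeStep ((k ⌈x⌉₊).exec X)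
  | read i j k => chargeStep ((k (X i j)).exec X)
  | sample k => (PMF.uniformOfFintype (Fin n)).bind fun i => chargeStep ((k i).exec X)
  | coin k => (PMF.uniformOfFintype Bool).bind fun b => chargeStep ((k b).exec X)

namespace Prog

variable {R : Type} {n d : ℕ} {A : Type}

/-! ### Single instructions and loops -/

/-- One bookkeeping step. -/
def tick : Prog R n d Unit := step ret

/-- Binary arithmetic as a program. -/
def arith (o : BinOp) (x y : R) : Prog R n d R := bin o x y ret

/-- Fill an array of length `m`, cell by cell, one extra step for every cell. -/
def tabulate : (m : ℕ) → (Fin m → Prog R n d A) → Prog R n d (Fin m → A)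
  | 0, _ => pure Fin.elim0
  | m + 1, f => do
      tick
      let a ← f 0
      let v ← tabulate m fun i => f i.succ
      pure (Fin.cons a v)

/-- The loop `for i = 0, …, m - 1 do s ← f i s`, one extra step for every iteration. -/
def loop : (m : ℕ) → (Fin m → A → Prog R n d A) → A → Prog R n d A
  | 0, _, s => pure s
  | m + 1, f, s => do
      tick
      let t ← f 0 s
      loop m (fun i => f i.succ) t

/-! ### The algorithm -/

/-- Draw a uniformly random input point and copy it. -/
def samplePoint : Prog R n d (Fin d → R) := do
  let i ← sample ret
  tabulate d fun j => read i j ret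

/-- A `d × c` matrix of independent uniformly random signs, scaled by `1 / √c`. -/
def signMatrix (c : ℕ) : Prog R n d (Fin d → Fin c → R) := do
  let cc ← ofNat c ret
  let s ← un .sqrt cc ret
  let one ← const 1 ret
  let zero ← const 0 ret
  let pos ← arith .div one s
  let neg ← arith .sub zero pos
  tabulate d fun _ => tabulate c fun _ => do
    let b ← coin ret
    pure (if b then pos else neg)

/-- The product `Gᵀ x`. -/
def project {c : ℕ} (G : Fin d → Fin c → R) (x : Fin d → R) : Prog R n d (Fin c → R) :=
  tabulate c fun k => do
    let zero ← const 0 ret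
    loop d (fun j acc => do
      let p ← arith .mul (G j k) (x j)
      arith .add acc p) zero

/-- The squared Euclidean distance of two vectors. -/
def sqDist {c : ℕ} (u v : Fin c → R) : Prog R n d R := do
  let zero ← const 0 ret
  loop c (fun k acc => do
    let t ← arith .sub (u k) (v k)
    let p ← arith .mul t t
    arith .add acc p) zero

/-- The number (in a real register) of the vectors `y j` at squared distance at most `r`
from `y i`. -/
def countClose {N c : ℕ} (y : Fin N → Fin c → R) (r : R) (i : Fin N) : Prog R n d R := do
  let zero ← const 0 ret
  let one ← const 1 ret
  loop N (fun j cnt => do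
    let s ← sqDist (y i) (y j)
    let b ← le s r ret
    if b then arith .add cnt one else pure cnt) zero

/-- Test whether `y i` has squared distance more than `r` from all `y j` with `sel j = true`. -/
def isSeparated {N c : ℕ} (y : Fin N → Fin c → R) (r : R) (sel : Fin N → Bool) (i : Fin N) :
    Prog R n d Bool :=
  loop N (fun j ok =>
    if sel j then do
      let s ← sqDist (y i) (y j)
      let b ← le s r ret
      pure (ok && !b)
    else pure ok) true

/-- Greedy clustering: run through the indices `i` and select `i` if at least `thr` of the vectors
are at squared distance at most `rIn` from `y i` and all the vectors selected before are at squared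
distance more than `rOut`. The result is the indicator of the selected indices. -/
def greedyCluster {N c : ℕ} (y : Fin N → Fin c → R) (thr rIn rOut : R) :
    Prog R n d (Fin N → Bool) :=
  loop N (fun i sel => do
    let cnt ← countClose y rIn i
    let dense ← le thr cnt ret
    let sep ← isSeparated y rOut sel i
    if dense && sep then do
      tick
      pure (Function.update sel i true)
    else pure sel) fun _ => false

/-- `⌈36 log(2 / δ) / α⌉`. -/
def sampleCount (α δ : R) : Prog R n d ℕ := do
  let two ← const 2 ret
  let q ← arith .div two δ
  let l ← un .log q ret
  let t ← const 36 ret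
  let p ← arith .mul t l
  let r ← arith .div p α
  ceil r ret

/-- `⌈K log(1 / (α δ))⌉`. -/
def sketchDim (K : ℕ) (α δ : R) : Prog R n d ℕ := do
  let one ← const 1 ret
  let m ← arith .mul α δ
  let q ← arith .div one m
  let l ← un .log q ret
  let t ← ofNat K ret
  let p ← arith .mul t l
  ceil p ret

end Prog

/-- What an execution of the algorithm leaves in memory: the sampled points, the projection matrix,
and the indicator of the returned subset of the sampled points. -/
structure Outcome (R : Type) (d : ℕ) where
  /-- Number of sampled points. -/
  N : ℕ
  /-- Dimension after the projection. -/
  c : ℕ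
  /-- The sampled points. -/
  pts : Fin N → Fin d → R
  /-- The random matrix. -/
  G : Matrix (Fin d) (Fin c) R
  /-- Indicator of the indices of the returned points. -/
  sel : Fin N → Bool

/-- `SamplePostProcess`, with projection dimension `⌈K log(1 / (α δ))⌉`. -/
def samplePostProcess {R : Type} {n d : ℕ} (K : ℕ) (α δ : R) : Prog R n d (Outcome R d) := do
  let N ← Prog.sampleCount α δ
  let pts ← Prog.tabulate N fun _ => Prog.samplePoint
  let c ← Prog.sketchDim K α δ
  let G ← Prog.signMatrix c
  let y ← Prog.tabulate N fun i => Prog.project G (pts i)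
  let dd ← Prog.ofNat d Prog.ret
  let a ← Prog.const (88 / 10) Prog.ret
  let rIn ← Prog.arith .mul a dd
  let b ← Prog.const (352 / 10) Prog.ret
  let rOut ← Prog.arith .mul b dd
  let NN ← Prog.ofNat N Prog.ret
  let p ← Prog.arith .mul α NN
  let three ← Prog.const 3 Prog.ret
  let thr ← Prog.arith .div p three
  let sel ← Prog.greedyCluster y thr rIn rOut
  pure ⟨N, c, pts, G, sel⟩

namespace Outcome

variable {d : ℕ}

/-- `‖Gᵀ (X_i - X_j)‖₂²` for the sampled points `X_i`, `X_j`. -/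
noncomputable def projSqDist (o : Outcome ℝ d) (i j : Fin o.N) : ℝ :=
  ‖(WithLp.toLp 2 (Matrix.mulVec o.G.transpose (o.pts i - o.pts j)) :
    EuclideanSpace ℝ (Fin o.c))‖ ^ 2

open Classical in
/-- The condition on the returned set `L`: every point of `L` is close, after projection, to at
least `α N / 3` of the sampled points, and distinct members of `L` are far apart after
projection. -/
def IsClusterSet (α : ℝ) (o : Outcome ℝ d) (L : Finset (Fin o.N)) : Prop :=
  ∀ i ∈ L,
    α * o.N / 3 ≤ ((Finset.univ.filter fun j => o.projSqDist i j ≤ 8.8 * d).card : ℝ) ∧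
    ∀ j ∈ L, j ≠ i → 35.2 * d < o.projSqDist i j

/-- The set of indices of the returned points. -/
def returned (o : Outcome ℝ d) : Finset (Fin o.N) :=
  Finset.univ.filter fun i => o.sel i = true

end Outcome

/-- At least a fraction `α` of the points `X` has second moment matrix about `μ` bounded by the
identity in the Loewner order. -/
def HasInliers {n d : ℕ} (X : Fin n → EuclideanSpace ℝ (Fin d)) (α : ℝ)
    (μ : EuclideanSpace ℝ (Fin d)) : Prop :=
  ∃ S : Finset (Fin n), α * n ≤ S.card ∧
    ((1 : Matrix (Fin d) (Fin d) ℝ) -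
      (S.card : ℝ)⁻¹ • ∑ i ∈ S, Matrix.vecMulVec (X i - μ).ofLp (X i - μ).ofLp).PosSemidef

/-! The trace of the second moment bound says that the inliers have mean squared distance at most
`d` from `μ`. By Markov's inequality half of them, hence a fraction `α / 2` of all points, are near,
within squared distance `2 d` (`HasInliers.card_near_ge`). Two independent events then suffice, each
failing with probability at most `δ / 2`: at least `α N / 3` sampled points are near
(`card_few_successes_le`), and the random sign matrix scales all squared distances between sampled
points by factors in `[1/4, 1.1]` (`card_isDistorted_le` and a union bound over pairs).

On these events the rest is geometry (`Outcome.exists_norm_sub_le`). Near points have mutual squared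
distance at most `8 d`, so at most `8.8 d` after projection, and each near point is dense. By
maximality of `L`, a near point is in `L` or has projected squared distance at most `35.2 d` from a
member of `L`. That member is then within `12 √d` of the near point and within `14 √d` of `μ`, and
`C d α ≤ 1` turns `√d` into a multiple of `1 / √α`.

The size bound is a packing argument valid in every execution: since `35.2 = 4 * 8.8`, the projected
balls of squared radius `8.8 d` about members of `L` are disjoint, and each holds `α N / 3` of the
`N` sampled points. The time is of order `N² c + N c d`, where `d = O(1 / α)`.

For programs, `Ensures` tracks postconditions and worst-case cost along the support, while `expect`
handles probabilities as iterated finite averages. -/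

section

open Finset

namespace Prog

variable {n d : ℕ} {A B : Type}

/-! ### Postconditions and running times -/

section Ensures

variable [NeZero n] {X : Fin n → EuclideanSpace ℝ (Fin d)}

/-- Every execution of `p` ends with a result that satisfies `Q`, after at most `T` steps. -/
def Ensures (X : Fin n → EuclideanSpace ℝ (Fin d)) (p : Prog ℝ n d A) (Q : A → Prop) (T : ℕ) :
    Prop :=
  ∀ o ∈ (p.exec X).support, Q o.1 ∧ o.2 ≤ T

theorem mem_support_chargeStep {p : PMF (A × ℕ)} {o : A × ℕ} :
    o ∈ (chargeStep p).support ↔ ∃ a ∈ p.support, (a.1, a.2 + 1) = o := by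
  simp only [chargeStep, PMF.support_map, Set.mem_image]

theorem exists_of_mem_support_chargeStep {p : PMF (B × ℕ)} {q : PMF (A × ℕ)}
    {f : A → PMF (B × ℕ)}
    (h : ∀ o ∈ p.support, ∃ a ∈ q.support, ∃ b ∈ (f a.1).support, o.1 = b.1 ∧ o.2 = a.2 + b.2)
    {o : B × ℕ} (ho : o ∈ (chargeStep p).support) :
    ∃ a ∈ (chargeStep q).support, ∃ b ∈ (f a.1).support, o.1 = b.1 ∧ o.2 = a.2 + b.2 := by
  obtain ⟨o', ho', rfl⟩ := mem_support_chargeStep.1 ho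
  obtain ⟨a, ha, b, hb, h1, h2⟩ := h o' ho'
  refine ⟨(a.1, a.2 + 1), mem_support_chargeStep.2 ⟨a, ha, rfl⟩, b, hb, h1, ?_⟩
  simp only [h2]
  omega

/-- Costs add under composition. This yields the sequencing rule `Ensures.bind`, from which all
running times are assembled. -/
theorem exists_of_mem_support_bind (p : Prog ℝ n d A) (f : A → Prog ℝ n d B) :
    ∀ o ∈ ((p.bind f).exec X).support,
      ∃ a ∈ (p.exec X).support, ∃ b ∈ ((f a.1).exec X).support, o.1 = b.1 ∧ o.2 = a.2 + b.2 := by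
  induction p with
  | ret a =>
    intro o ho
    exact ⟨(a, 0), by simp [exec], o, ho, rfl, by simp⟩
  | step k ih => exact fun o ho =>
    exists_of_mem_support_chargeStep (f := fun a => (f a).exec X) (ih ()) ho
  | const q k ih => exact fun o ho =>
    exists_of_mem_support_chargeStep (f := fun a => (f a).exec X) (ih _) ho
  | ofNat m k ih => exact fun o ho =>
    exists_of_mem_support_chargeStep (f := fun a => (f a).exec X) (ih _) ho
  | bin o x y k ih => exact fun o ho =>
    exists_of_mem_support_chargeStep (f := fun a => (f a).exec X) (ih _) ho
  | un o x k ih => exact fun o ho =>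
    exists_of_mem_support_chargeStep (f := fun a => (f a).exec X) (ih _) ho
  | le x y k ih => exact fun o ho =>
    exists_of_mem_support_chargeStep (f := fun a => (f a).exec X) (ih _) ho
  | ceil x k ih => exact fun o ho =>
    exists_of_mem_support_chargeStep (f := fun a => (f a).exec X) (ih _) ho
  | read i j k ih => exact fun o ho =>
    exists_of_mem_support_chargeStep (f := fun a => (f a).exec X) (ih _) ho
  | sample k ih =>
    intro o ho
    obtain ⟨i, hi, ho⟩ := (PMF.mem_support_bind_iff _ _ _).1 ho
    obtain ⟨a, ha, h⟩ :=
      exists_of_mem_support_chargeStep (f := fun a => (f a).exec X) (ih i) ho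
    exact ⟨a, (PMF.mem_support_bind_iff _ _ _).2 ⟨i, hi, ha⟩, h⟩
  | coin k ih =>
    intro o ho
    obtain ⟨i, hi, ho⟩ := (PMF.mem_support_bind_iff _ _ _).1 ho
    obtain ⟨a, ha, h⟩ :=
      exists_of_mem_support_chargeStep (f := fun a => (f a).exec X) (ih i) ho
    exact ⟨a, (PMF.mem_support_bind_iff _ _ _).2 ⟨i, hi, ha⟩, h⟩

theorem Ensures.bind {p : Prog ℝ n d A} {f : A → Prog ℝ n d B} {P : A → Prop} {Q : B → Prop}
    {S T : ℕ} (hp : Ensures X p P S) (hf : ∀ a, P a → Ensures X (f a) Q T) :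
    Ensures X (p >>= f) Q (S + T) := by
  intro o ho
  obtain ⟨a, ha, b, hb, h1, h2⟩ := exists_of_mem_support_bind p f o ho
  have h3 := hp a ha
  have h4 := hf _ h3.1 b hb
  rw [h1, h2]
  exact ⟨h4.1, add_le_add h3.2 h4.2⟩

theorem Ensures.mono {p : Prog ℝ n d A} {P Q : A → Prop} {S T : ℕ} (hp : Ensures X p P S)
    (hPQ : ∀ a, P a → Q a) (hST : S ≤ T) : Ensures X p Q T :=
  fun o ho => ⟨hPQ _ (hp o ho).1, (hp o ho).2.trans hST⟩

theorem Ensures.pure {a : A} {Q : A → Prop} (h : Q a) :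
    Ensures X (Pure.pure a : Prog ℝ n d A) Q 0 := by
  intro o ho
  have : o = (a, 0) := by
    simpa using (show o ∈ (PMF.pure (a, 0) : PMF (A × ℕ)).support from ho)
  subst this
  exact ⟨h, le_rfl⟩

theorem ensures_of_exec_eq {p : Prog ℝ n d A} {a : A} (h : p.exec X = chargeStep (PMF.pure (a, 0))) :
    Ensures X p (· = a) 1 := by
  intro o ho
  rw [h, mem_support_chargeStep] at ho
  obtain ⟨b, hb, rfl⟩ := ho
  have hb' : b = (a, 0) := by simpa using hb
  subst hb'
  exact ⟨rfl, le_rfl⟩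

theorem ensures_tick : Ensures X (tick : Prog ℝ n d Unit) (fun _ => True) 1 :=
  (ensures_of_exec_eq (a := ()) rfl).mono (fun _ _ => trivial) le_rfl

theorem ensures_const (q : ℚ) : Ensures X (const q ret) (· = (q : ℝ)) 1 := ensures_of_exec_eq rfl

theorem ensures_ofNat (m : ℕ) : Ensures X (ofNat m ret) (· = (m : ℝ)) 1 := ensures_of_exec_eq rfl

theorem ensures_arith (o : BinOp) (x y : ℝ) : Ensures X (arith o x y) (· = o.eval x y) 1 :=
  ensures_of_exec_eq rfl

theorem ensures_un (o : UnOp) (x : ℝ) : Ensures X (un o x ret) (· = o.eval x) 1 :=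
  ensures_of_exec_eq rfl

open Classical in
theorem ensures_le (x y : ℝ) : Ensures X (le x y ret) (· = decide (x ≤ y)) 1 :=
  ensures_of_exec_eq rfl

theorem ensures_ceil (x : ℝ) : Ensures X (ceil x ret) (· = ⌈x⌉₊) 1 := ensures_of_exec_eq rfl

theorem ensures_read (i : Fin n) (j : Fin d) : Ensures X (read i j ret) (· = X i j) 1 :=
  ensures_of_exec_eq rfl

theorem ensures_sample : Ensures X (sample ret) (fun _ => True) 1 := by
  intro o ho
  obtain ⟨i, -, ho⟩ := (PMF.mem_support_bind_iff _ _ _).1 ho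
  -- Once the index is drawn, what remains has the law of a deterministic one-step program.
  exact ⟨trivial, (ensures_of_exec_eq (X := X) (p := step fun _ => ret i) rfl o ho).2⟩

theorem ensures_coin : Ensures X (coin ret) (fun _ => True) 1 := by
  intro o ho
  obtain ⟨i, -, ho⟩ := (PMF.mem_support_bind_iff _ _ _).1 ho
  exact ⟨trivial, (ensures_of_exec_eq (X := X) (p := step fun _ => ret i) rfl o ho).2⟩

theorem ensures_tabulate {T : ℕ} : ∀ {m : ℕ} {f : Fin m → Prog ℝ n d A} {P : Fin m → A → Prop},
    (∀ i, Ensures X (f i) (P i) T) →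
      Ensures X (tabulate m f) (fun v => ∀ i, P i (v i)) (m * (T + 1))
  | 0, _, _, _ => (Ensures.pure (Q := fun _ => True) trivial).mono (fun _ _ i => i.elim0) (by simp)
  | m + 1, f, P, h => by
    refine (ensures_tick.bind fun _ _ => (h 0).bind fun a ha =>
      (ensures_tabulate fun i : Fin m => h i.succ).bind fun v hv =>
        Ensures.pure (Q := fun v : Fin (m + 1) → A => ∀ i, P i (v i)) ?_).mono (fun _ h => h) ?_
    · exact Fin.cases ha hv
    · exact le_of_eq (by ring)

/-- The invariant rule: `I k` describes the state after `k` iterations. Peeling off the first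
iteration shifts the invariant by one. -/
theorem ensures_loop {T : ℕ} : ∀ {m : ℕ} {f : Fin m → A → Prog ℝ n d A} {I : ℕ → A → Prop} {s : A},
    I 0 s → (∀ (i : Fin m) a, I i a → Ensures X (f i a) (I (i + 1)) T) →
      Ensures X (loop m f s) (I m) (m * (T + 1))
  | 0, _, _, _, h, _ => (Ensures.pure h).mono (fun _ h => h) (by simp)
  | m + 1, f, I, s, h0, h => by
    refine (ensures_tick.bind fun _ _ => (h 0 s h0).bind fun a ha =>
      ensures_loop (I := fun k => I (k + 1)) ha fun i a hi => h i.succ a hi).mono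
        (fun _ h => h) ?_
    exact le_of_eq (by ring)

theorem ensures_loop_sum {T : ℕ} : ∀ {m : ℕ} {f : Fin m → ℝ → Prog ℝ n d ℝ} {g : Fin m → ℝ} {s : ℝ},
    (∀ i a, Ensures X (f i a) (· = a + g i) T) →
      Ensures X (loop m f s) (· = s + ∑ i, g i) (m * (T + 1))
  | 0, _, _, _, _ => (Ensures.pure rfl).mono (fun a h => by simp [h]) (by simp)
  | m + 1, f, g, s, h => by
    refine (ensures_tick.bind fun _ _ => (h 0 s).bind (Q := (· = s + ∑ i, g i)) fun a ha =>
      (ensures_loop_sum (g := fun i => g i.succ) fun i a => h i.succ a).mono (fun b hb => ?_)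
        le_rfl).mono (fun _ h => h) ?_
    · rw [hb, ha, Fin.sum_univ_succ, add_assoc]
    · exact le_of_eq (by ring)

theorem ensures_loop_and {T : ℕ} : ∀ {m : ℕ} {f : Fin m → Bool → Prog ℝ n d Bool}
    {P : Fin m → Prop} {s : Bool},
    (∀ i b, Ensures X (f i b) (fun b' => b' = true ↔ b = true ∧ P i) T) →
      Ensures X (loop m f s) (fun b => b = true ↔ s = true ∧ ∀ i, P i) (m * (T + 1))
  | 0, _, _, _, _ => (Ensures.pure rfl).mono (fun a h => by simp [h]) (by simp)
  | m + 1, f, P, s, h => by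
    refine (ensures_tick.bind fun _ _ => (h 0 s).bind
      (Q := fun b => b = true ↔ s = true ∧ ∀ i, P i) fun a ha =>
      (ensures_loop_and (P := fun i => P i.succ) fun i a => h i.succ a).mono (fun b hb => ?_)
        le_rfl).mono (fun _ h => h) ?_
    · rw [hb, ha, Fin.forall_fin_succ, and_assoc]
    · exact le_of_eq (by ring)

end Ensures

/-! ### Expectations -/

section Expectation

variable {X : Fin n → EuclideanSpace ℝ (Fin d)}

open Classical in
/-- The expectation of `f` at the result of a program. -/
noncomputable def expect (X : Fin n → EuclideanSpace ℝ (Fin d)) :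
    Prog ℝ n d A → (A → ENNReal) → ENNReal
  | ret a, f => f a
  | step k, f => (k ()).expect X f
  | const q k, f => (k (q : ℝ)).expect X f
  | ofNat m k, f => (k (m : ℝ)).expect X f
  | bin o x y k, f => (k (o.eval x y)).expect X f
  | un o x k, f => (k (o.eval x)).expect X f
  | le x y k, f => (k (decide (x ≤ y))).expect X f
  | ceil x k, f => (k ⌈x⌉₊).expect X f
  | read i j k, f => (k (X i j)).expect X f
  | sample k, f => (Fintype.card (Fin n) : ENNReal)⁻¹ * ∑ i, (k i).expect X f
  | coin k, f => (Fintype.card Bool : ENNReal)⁻¹ * ∑ b, (k b).expect X f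

theorem expect_bind (p : Prog ℝ n d A) (g : A → Prog ℝ n d B) (f : B → ENNReal) :
    (p >>= g).expect X f = p.expect X fun a => (g a).expect X f := by
  change (p.bind g).expect X f = _
  induction p with
  | ret a => rfl
  | _ => simp only [Prog.bind, expect, *]

theorem toOuterMeasure_chargeStep (p : PMF (A × ℕ)) (Q : Set A) :
    (chargeStep p).toOuterMeasure {o | o.1 ∈ Q} = p.toOuterMeasure {o | o.1 ∈ Q} := by
  rw [chargeStep, PMF.toOuterMeasure_map_apply]
  rfl

/-- Passes from probabilities under `exec` to `expect`, where costs are forgotten and every draw is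
a finite average. -/
theorem toOuterMeasure_exec [NeZero n] (p : Prog ℝ n d A) (Q : Set A) :
    (p.exec X).toOuterMeasure {o | o.1 ∈ Q} = p.expect X (Q.indicator 1) := by
  induction p with
  | ret a =>
    simp only [exec, expect, PMF.toOuterMeasure_pure_apply, Set.indicator]
    rfl
  | sample k ih =>
    simp only [exec, expect, PMF.toOuterMeasure_bind_apply, toOuterMeasure_chargeStep, ih,
      tsum_fintype, PMF.uniformOfFintype_apply, mul_sum]
  | coin k ih =>
    simp only [exec, expect, PMF.toOuterMeasure_bind_apply, toOuterMeasure_chargeStep, ih,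
      tsum_fintype, PMF.uniformOfFintype_apply, mul_sum]
  | _ => simp_all only [exec, expect, toOuterMeasure_chargeStep]

/-- The result of `p` is distributed as `g ω` for a uniformly random `ω`. -/
def IsUniform {Ω : Type} [Fintype Ω] (X : Fin n → EuclideanSpace ℝ (Fin d)) (p : Prog ℝ n d A)
    (g : Ω → A) : Prop :=
  ∀ f, p.expect X f = (Fintype.card Ω : ENNReal)⁻¹ * ∑ ω, f (g ω)

/-- Independence of repeated draws: uniform averages over `Ω` and `Fin m → Ω` combine to one over
`Fin (m + 1) → Ω` through `Fin.consEquiv`. -/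
theorem isUniform_tabulate {Ω : Type} [Fintype Ω] {p : Prog ℝ n d A} {g : Ω → A}
    (h : IsUniform X p g) : ∀ m : ℕ,
    IsUniform X (tabulate m fun _ => p) (fun (ω : Fin m → Ω) i => g (ω i))
  | 0 => fun f => by
    change f Fin.elim0 = _
    simp only [Fintype.card_unique, Nat.cast_one, inv_one, one_mul, univ_unique, sum_singleton]
    exact congrArg f (Subsingleton.elim _ _)
  | m + 1 => fun f => by
    have ih := isUniform_tabulate h m
    have h1 : (tabulate (m + 1) fun _ => p).expect X f =
        p.expect X fun a => (tabulate m fun _ => p).expect X fun v => f (Fin.cons a v) := by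
      simp only [Prog.tabulate, expect_bind]
      rfl
    rw [h1, h]
    simp_rw [ih (fun v => f (Fin.cons (g _) v))]
    rw [← (Fin.consEquiv fun _ : Fin (m + 1) => Ω).sum_comp, Fintype.sum_prod_type, ← mul_sum,
      ← mul_assoc, ← ENNReal.mul_inv (Or.inr (by simp)) (Or.inl (by simp))]
    congr 1
    · simp [pow_succ, mul_comm]
    · refine sum_congr rfl fun a _ => sum_congr rfl fun ω _ => congrArg f ?_
      funext i
      refine Fin.cases ?_ (fun i => ?_) i <;> simp [Fin.consEquiv]

/-- Lets a postcondition evaluate an expectation, so stretches of a program without relevant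
randomness collapse inside `expect`. -/
theorem expect_eq_of_forall_support [NeZero n] (p : Prog ℝ n d A) {f : A → ENNReal} {c : ENNReal}
    (h : ∀ o ∈ (p.exec X).support, f o.1 = c) : p.expect X f = c := by
  have aux : ∀ {q : PMF (A × ℕ)}, (∀ o ∈ (chargeStep q).support, f o.1 = c) →
      ∀ o ∈ q.support, f o.1 = c := fun hq o ho =>
    hq (o.1, o.2 + 1) (mem_support_chargeStep.2 ⟨o, ho, rfl⟩)
  induction p with
  | ret a => exact h (a, 0) (by simp [exec])
  | sample k ih =>
    have h1 : ∀ i, (k i).expect X f = c := fun i => ih i (aux fun o ho => h o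
      ((PMF.mem_support_bind_iff _ _ _).2 ⟨i, by simp, ho⟩))
    simp only [expect, h1, sum_const, card_univ, nsmul_eq_mul]
    rw [← mul_assoc, ENNReal.inv_mul_cancel (by simp [NeZero.ne]) (by simp), one_mul]
  | coin k ih =>
    have h1 : ∀ i, (k i).expect X f = c := fun i => ih i (aux fun o ho => h o
      ((PMF.mem_support_bind_iff _ _ _).2 ⟨i, by simp, ho⟩))
    simp only [expect, h1, sum_const, card_univ, nsmul_eq_mul]
    rw [← mul_assoc, ENNReal.inv_mul_cancel (by simp) (by simp), one_mul]
  | _ => rename_i ih; exact ih _ (aux h)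

theorem Ensures.expect_eq [NeZero n] {p : Prog ℝ n d A} {Q : A → Prop} {T : ℕ}
    (hp : Ensures X p Q T) {f : A → ENNReal} {c : ENNReal} (h : ∀ a, Q a → f a = c) :
    p.expect X f = c :=
  expect_eq_of_forall_support p fun o ho => h _ (hp o ho).1

end Expectation

end Prog

/-! ### What the algorithm computes and how long it takes -/

open Classical in
/-- The selection `sel` consists of dense points at mutual distance more than `rOut`, and every other
dense point is within `rOut` of a selected one. -/
def IsGreedySelection {N : ℕ} (D : Fin N → Fin N → ℝ) (thr rIn rOut : ℝ) (sel : Fin N → Bool) :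
    Prop :=
  (∀ i, sel i = true → thr ≤ (#{j | D i j ≤ rIn} : ℝ)) ∧
  (∀ i j, sel i = true → sel j = true → j ≠ i → rOut < D i j) ∧
  ∀ i, thr ≤ (#{j | D i j ≤ rIn} : ℝ) → sel i = false → ∃ j, sel j = true ∧ D i j ≤ rOut

/-- `samplePostProcess` after the random choices. -/
def clusterPhase {R : Type} {n d : ℕ} (α : R) (N c : ℕ) (pts : Fin N → Fin d → R)
    (G : Matrix (Fin d) (Fin c) R) : Prog R n d (Outcome R d) := do
  let y ← Prog.tabulate N fun i => Prog.project G (pts i)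
  let dd ← Prog.ofNat d Prog.ret
  let a ← Prog.const (88 / 10) Prog.ret
  let rIn ← Prog.arith .mul a dd
  let b ← Prog.const (352 / 10) Prog.ret
  let rOut ← Prog.arith .mul b dd
  let NN ← Prog.ofNat N Prog.ret
  let p ← Prog.arith .mul α NN
  let three ← Prog.const 3 Prog.ret
  let thr ← Prog.arith .div p three
  let sel ← Prog.greedyCluster y thr rIn rOut
  pure ⟨N, c, pts, G, sel⟩

/-- Separates the random choices from `clusterPhase`, which is deterministic given the sample and
the matrix. -/
theorem samplePostProcess_eq {R : Type} {n d : ℕ} (K : ℕ) (α δ : R) :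
    (samplePostProcess K α δ : Prog R n d (Outcome R d)) =
      (Prog.sampleCount α δ >>= fun N => (Prog.tabulate N fun _ => Prog.samplePoint) >>= fun pts =>
        Prog.sketchDim K α δ >>= fun c => Prog.signMatrix c >>= fun G =>
          clusterPhase α N c pts G) := rfl

namespace Prog

variable {n d : ℕ} [NeZero n] {X : Fin n → EuclideanSpace ℝ (Fin d)} {A B : Type}

theorem Ensures.bind_eq {p : Prog ℝ n d A} {f : A → Prog ℝ n d B} {a : A} {Q : B → Prop}
    {S T : ℕ} (hp : Ensures X p (· = a) S) (hf : Ensures X (f a) Q T) :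
    Ensures X (p >>= f) Q (S + T) :=
  hp.bind fun _ hb => hb ▸ hf

theorem Ensures.ite {c : Prop} [Decidable c] {p q : Prog ℝ n d A} {Q : A → Prop} {S T : ℕ}
    (hp : c → Ensures X p Q S) (hq : ¬ c → Ensures X q Q T) :
    Ensures X (if c then p else q) Q (max S T) := by
  split_ifs with h
  · exact (hp h).mono (fun _ h => h) (le_max_left _ _)
  · exact (hq h).mono (fun _ h => h) (le_max_right _ _)

theorem ensures_samplePoint : Ensures X samplePoint (fun _ => True) (1 + d * 2) :=
  ensures_sample.bind fun i _ =>
    (ensures_tabulate (P := fun _ _ => True) fun j => (ensures_read i j).mono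
      (fun _ _ => trivial) le_rfl).mono (fun _ _ => trivial) le_rfl

theorem ensures_signMatrix (c : ℕ) :
    Ensures X (signMatrix c) (fun _ => True) (6 + d * (c * 2 + 1)) := by
  have hbit : ∀ pos neg : ℝ, Ensures X (tabulate d fun _ => tabulate c fun _ =>
      coin ret >>= fun b => Pure.pure (if b then pos else neg)) (fun _ => True)
      (d * (c * (1 + 0 + 1) + 1)) := fun pos neg =>
    (ensures_tabulate (P := fun _ _ => True) fun _ =>
      (ensures_tabulate (P := fun _ _ => True) fun _ =>
        ensures_coin.bind fun b _ => Ensures.pure trivial).mono (fun _ _ => trivial) le_rfl).mono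
          (fun _ _ => trivial) le_rfl
  have h : Ensures X (signMatrix c) (fun _ => True)
      (1 + (1 + (1 + (1 + (1 + (1 + d * (c * (1 + 0 + 1) + 1))))))) := by
    refine (ensures_ofNat c).bind_eq ?_
    refine (ensures_un _ _).bind_eq ?_
    refine (ensures_const 1).bind_eq ?_
    refine (ensures_const 0).bind_eq ?_
    refine (ensures_arith _ _ _).bind_eq ?_
    refine (ensures_arith _ _ _).bind_eq ?_
    exact hbit _ _
  exact h.mono (fun _ h => h) (le_of_eq (by ring))

theorem ensures_project {c : ℕ} (G : Matrix (Fin d) (Fin c) ℝ) (x : Fin d → ℝ) :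
    Ensures X (project G x) (· = Matrix.mulVec G.transpose x) (c * (d * 3 + 2)) := by
  refine (ensures_tabulate fun k => (ensures_const 0).bind_eq <|
    ensures_loop_sum (T := 2) (g := fun j => G j k * x j) fun j acc =>
      (ensures_arith _ _ _).bind_eq <| ensures_arith _ _ _).mono (fun v hv => ?_) ?_
  · funext k
    rw [hv k]
    simp [Matrix.mulVec, dotProduct]
  · exact le_of_eq (by ring)

theorem ensures_sqDist {c : ℕ} (u v : Fin c → ℝ) :
    Ensures X (sqDist u v) (· = ∑ k, (u k - v k) ^ 2) (1 + c * 4) := by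
  have hstep : ∀ k acc, Ensures X (do
      let t ← arith .sub (u k) (v k)
      let p ← arith .mul t t
      arith .add acc p) (· = acc + (u k - v k) ^ 2) (1 + (1 + 1)) := by
    intro k acc
    refine (ensures_arith _ _ _).bind_eq ?_
    refine (ensures_arith _ _ _).bind_eq ?_
    refine (ensures_arith _ _ _).mono (fun a ha => ?_) le_rfl
    rw [ha, sq]
    rfl
  have h : Ensures X (sqDist u v) (· = (0 : ℚ) + ∑ k, (u k - v k) ^ 2) (1 + c * (1 + (1 + 1) + 1)) :=
    (ensures_const 0).bind_eq (ensures_loop_sum hstep)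
  exact h.mono (fun a ha => by simpa using ha) le_rfl

open Classical in
theorem ensures_countClose {N c : ℕ} (y : Fin N → Fin c → ℝ) (r : ℝ) (i : Fin N) :
    Ensures X (countClose y r i) (· = (#{j | ∑ k, (y i k - y j k) ^ 2 ≤ r} : ℝ))
      (2 + N * (c * 4 + 4)) := by
  have hstep : ∀ j cnt, Ensures X (do
      let s ← sqDist (y i) (y j)
      let b ← le s r ret
      if b then arith .add cnt ((1 : ℚ) : ℝ) else Pure.pure cnt)
      (· = cnt + if ∑ k, (y i k - y j k) ^ 2 ≤ r then 1 else 0) (1 + c * 4 + (1 + max 1 0)) := by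
    intro j cnt
    refine (ensures_sqDist _ _).bind_eq ?_
    refine (ensures_le _ _).bind_eq ?_
    refine Ensures.ite (fun h => ?_) fun h => Ensures.pure ?_
    · refine (ensures_arith _ _ _).mono (fun a ha => ?_) le_rfl
      rw [ha, if_pos (by simpa using h)]
      simp [BinOp.eval]
    · rw [if_neg (by simpa using h), add_zero]
  have h : Ensures X (countClose y r i)
      (· = (0 : ℚ) + ∑ j, if ∑ k, (y i k - y j k) ^ 2 ≤ r then (1 : ℝ) else 0)
      (1 + (1 + N * (1 + c * 4 + (1 + max 1 0) + 1))) := by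
    refine (ensures_const 0).bind_eq ?_
    refine (ensures_const 1).bind_eq ?_
    exact ensures_loop_sum hstep
  exact h.mono (fun a ha => by simpa using ha) (le_of_eq (by simp only [max_def]; norm_num; ring))

theorem ensures_isSeparated {N c : ℕ} (y : Fin N → Fin c → ℝ) (r : ℝ) (sel : Fin N → Bool)
    (i : Fin N) :
    Ensures X (isSeparated y r sel i)
      (fun b => b = true ↔ ∀ j, sel j = true → r < ∑ k, (y i k - y j k) ^ 2)
      (N * (c * 4 + 3)) := by
  have hstep : ∀ j ok, Ensures X (if sel j = true then do
      let s ← sqDist (y i) (y j)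
      let b ← le s r ret
      Pure.pure (ok && !b)
      else Pure.pure ok)
      (fun b => b = true ↔ ok = true ∧ (sel j = true → r < ∑ k, (y i k - y j k) ^ 2))
      (max (1 + c * 4 + (1 + 0)) 0) := by
    intro j ok
    refine Ensures.ite (fun h => ?_) fun h => Ensures.pure (by simp [h])
    refine (ensures_sqDist _ _).bind_eq ?_
    refine (ensures_le _ _).bind_eq ?_
    exact Ensures.pure (by simp [h])
  refine Ensures.mono (ensures_loop_and hstep) (fun b hb => by simpa using hb) (le_of_eq ?_)
  simp only [zero_le, sup_of_le_left]
  ring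

/-- Selections are never revoked, so a dense index rejected for being close to a selected one stays
close to a selected one. -/
theorem ensures_greedyCluster {N c : ℕ} (y : Fin N → Fin c → ℝ) (thr rIn rOut : ℝ) :
    Ensures X (greedyCluster y thr rIn rOut)
      (IsGreedySelection (fun i j => ∑ k, (y i k - y j k) ^ 2) thr rIn rOut)
      (N * (N * (c * 8 + 7) + 5)) := by
  classical
  set D : Fin N → Fin N → ℝ := fun i j => ∑ k, (y i k - y j k) ^ 2 with hD
  have hsymm : ∀ i j, D i j = D j i := fun i j => sum_congr rfl fun k _ => by ring
  -- After `m` iterations only indices below `m` are selected or known to be covered; at `m = N`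
  -- this is `IsGreedySelection`.
  let I : ℕ → (Fin N → Bool) → Prop := fun m sel =>
    (∀ i, sel i = true → i.1 < m ∧ thr ≤ (#{j | D i j ≤ rIn} : ℝ)) ∧
    (∀ i j, sel i = true → sel j = true → j ≠ i → rOut < D i j) ∧
    ∀ i : Fin N, i.1 < m → thr ≤ (#{j | D i j ≤ rIn} : ℝ) → sel i = false →
      ∃ j, sel j = true ∧ D i j ≤ rOut
  have hstep : ∀ (i : Fin N) sel, I i sel → Ensures X (do
      let cnt ← countClose y rIn i
      let dense ← le thr cnt ret
      let sep ← isSeparated y rOut sel i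
      if dense && sep then do
        tick
        Pure.pure (Function.update sel i true)
      else Pure.pure sel) (I (i + 1))
      (2 + N * (c * 4 + 4) + (1 + (N * (c * 4 + 3) + max (1 + 0) 0))) := by
    intro i sel hI
    refine (ensures_countClose y rIn i).bind_eq ?_
    refine (ensures_le _ _).bind_eq ?_
    refine (ensures_isSeparated y rOut sel i).bind fun b hb => ?_
    refine Ensures.ite (fun h => ensures_tick.bind fun _ _ => Ensures.pure ?_)
      fun h => Ensures.pure ?_
    · obtain ⟨h1, h2, h3⟩ := hI
      simp only [Bool.and_eq_true, decide_eq_true_eq, hb] at h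
      have hsel : ∀ j, Function.update sel i true j = true ↔ j = i ∨ sel j = true := by
        intro j
        by_cases hj : j = i <;> simp [hj]
      refine ⟨fun j hj => ?_, fun j k hj hk hjk => ?_, fun j hj hd hs => ?_⟩
      · rcases (hsel j).1 hj with rfl | hj
        · exact ⟨Nat.lt_succ_self _, h.1⟩
        · exact ⟨Nat.lt_succ_of_lt (h1 j hj).1, (h1 j hj).2⟩
      · rcases (hsel j).1 hj with hj | hj <;> rcases (hsel k).1 hk with hk | hk
        · exact absurd (hk.trans hj.symm) hjk
        · exact hj ▸ h.2 k hk
        · rw [hsymm]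
          exact hk ▸ h.2 j hj
        · exact h2 j k hj hk hjk
      · have hji : j ≠ i := by
          rintro rfl
          simp at hs
        have hlt : j.1 < i.1 := lt_of_le_of_ne (Nat.lt_succ_iff.1 hj) fun h => hji (Fin.ext h)
        rw [Function.update_of_ne hji] at hs
        obtain ⟨k, hk, hk'⟩ := h3 j hlt hd hs
        exact ⟨k, (hsel k).2 (Or.inr hk), hk'⟩
    · obtain ⟨h1, h2, h3⟩ := hI
      simp only [Bool.and_eq_true, decide_eq_true_eq, hb] at h
      refine ⟨fun j hj => ⟨Nat.lt_succ_of_lt (h1 j hj).1, (h1 j hj).2⟩, h2, fun j hj hd hs => ?_⟩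
      rcases (Nat.lt_succ_iff_lt_or_eq.1 hj) with hlt | heq
      · exact h3 j hlt hd hs
      · obtain rfl : j = i := Fin.ext heq
        by_contra! hne
        exact h ⟨hd, hne⟩
  refine Ensures.mono (ensures_loop (I := I) ⟨by simp, by simp, by simp⟩ hstep)
    (fun sel hsel => ⟨fun i hi => (hsel.1 i hi).2, hsel.2.1, fun i => hsel.2.2 i i.2⟩) (le_of_eq ?_)
  rw [max_eq_left (by norm_num)]
  ring

theorem ensures_sampleCount (α δ : ℝ) :
    Ensures X (sampleCount α δ) (· = ⌈36 * Real.log (2 / δ) / α⌉₊) 7 := by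
  refine ((ensures_const 2).bind_eq <| (ensures_arith _ _ _).bind_eq <| (ensures_un _ _).bind_eq <|
    (ensures_const 36).bind_eq <| (ensures_arith _ _ _).bind_eq <| (ensures_arith _ _ _).bind_eq <|
    ensures_ceil _).mono (fun a ha => ?_) le_rfl
  simpa [BinOp.eval, UnOp.eval] using ha

theorem ensures_sketchDim (K : ℕ) (α δ : ℝ) :
    Ensures X (sketchDim K α δ) (· = ⌈K * Real.log (1 / (α * δ))⌉₊) 7 := by
  refine ((ensures_const 1).bind_eq <| (ensures_arith _ _ _).bind_eq <|
    (ensures_arith _ _ _).bind_eq <| (ensures_un _ _).bind_eq <|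
    (ensures_ofNat K).bind_eq <| (ensures_arith _ _ _).bind_eq <|
    ensures_ceil _).mono (fun a ha => ?_) le_rfl
  simpa [BinOp.eval, UnOp.eval] using ha

end Prog

theorem Outcome.projSqDist_eq {d : ℕ} (o : Outcome ℝ d) (i j : Fin o.N) :
    o.projSqDist i j = ∑ k, (Matrix.mulVec o.G.transpose (o.pts i) k -
      Matrix.mulVec o.G.transpose (o.pts j) k) ^ 2 := by
  simp [Outcome.projSqDist, EuclideanSpace.norm_sq_eq, Matrix.mulVec_sub]

namespace Prog

variable {n d : ℕ} [NeZero n] {X : Fin n → EuclideanSpace ℝ (Fin d)}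

theorem ensures_clusterPhase (α : ℝ) (N c : ℕ) (pts : Fin N → Fin d → ℝ)
    (G : Matrix (Fin d) (Fin c) ℝ) :
    Ensures X (clusterPhase α N c pts G) (fun o => ∃ sel, o = ⟨N, c, pts, G, sel⟩ ∧
        IsGreedySelection o.projSqDist (α * o.N / 3) (8.8 * d) (35.2 * d) o.sel)
      (N * (c * (d * 3 + 2) + 1) + 9 + N * (N * (c * 8 + 7) + 5)) := by
  have h : Ensures X (clusterPhase α N c pts G) (fun o => ∃ sel, o = ⟨N, c, pts, G, sel⟩ ∧
        IsGreedySelection o.projSqDist (α * o.N / 3) (8.8 * d) (35.2 * d) o.sel)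
      (N * (c * (d * 3 + 2) + 1) + (1 + (1 + (1 + (1 + (1 + (1 + (1 + (1 + (1 +
        (N * (N * (c * 8 + 7) + 5) + 0))))))))))) := by
    refine (ensures_tabulate fun i => ensures_project G (pts i)).bind fun y hy => ?_
    refine (ensures_ofNat d).bind_eq ?_
    refine (ensures_const _).bind_eq ?_
    refine (ensures_arith _ _ _).bind_eq ?_
    refine (ensures_const _).bind_eq ?_
    refine (ensures_arith _ _ _).bind_eq ?_
    refine (ensures_ofNat N).bind_eq ?_
    refine (ensures_arith _ _ _).bind_eq ?_
    refine (ensures_const 3).bind_eq ?_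
    refine (ensures_arith _ _ _).bind_eq ?_
    refine (ensures_greedyCluster _ _ _ _).bind fun sel hsel => Ensures.pure ⟨sel, rfl, ?_⟩
    obtain rfl : y = fun i => Matrix.mulVec G.transpose (pts i) := funext hy
    have hD : Outcome.projSqDist ⟨N, c, pts, G, sel⟩ = fun i j =>
        ∑ k, (Matrix.mulVec G.transpose (pts i) k - Matrix.mulVec G.transpose (pts j) k) ^ 2 := by
      funext i j
      exact Outcome.projSqDist_eq _ i j
    rw [hD]
    convert hsel using 1 <;> norm_num [BinOp.eval]
  exact h.mono (fun _ h => h) (by omega)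

/-- Running time of `samplePostProcess` with sample size `N` and sketch dimension `c`. -/
def costBound (d N c : ℕ) : ℕ :=
  7 + (N * (1 + d * 2 + 1) + (7 + ((6 + d * (c * 2 + 1)) +
    (N * (c * (d * 3 + 2) + 1) + 9 + N * (N * (c * 8 + 7) + 5)))))

theorem ensures_samplePostProcess (K : ℕ) (α δ : ℝ) :
    Ensures X (samplePostProcess K α δ) (fun o => o.N = ⌈36 * Real.log (2 / δ) / α⌉₊ ∧
        IsGreedySelection o.projSqDist (α * o.N / 3) (8.8 * d) (35.2 * d) o.sel)
      (costBound d ⌈36 * Real.log (2 / δ) / α⌉₊ ⌈K * Real.log (1 / (α * δ))⌉₊) := by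
  rw [samplePostProcess_eq]
  refine (ensures_sampleCount α δ).bind_eq ?_
  refine (ensures_tabulate (P := fun _ _ => True) fun _ => ensures_samplePoint).bind fun pts _ => ?_
  refine (ensures_sketchDim K α δ).bind_eq ?_
  refine (ensures_signMatrix _).bind fun G _ => (ensures_clusterPhase α _ _ pts G).mono ?_ le_rfl
  rintro o ⟨sel, rfl, h⟩
  exact ⟨rfl, h⟩

end Prog

/-! ### Maximality of the greedy selection and the packing bound. -/

namespace Outcome

variable {d : ℕ} {o : Outcome ℝ d} {α : ℝ}

theorem projSqDist_comm (i j : Fin o.N) : o.projSqDist i j = o.projSqDist j i := by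
  simp only [projSqDist_eq]
  exact sum_congr rfl fun k _ => by ring

/-- Every unselected dense point is too close to a selected one, so no larger set can satisfy the
separation condition. -/
theorem maximal_returned
    (h : IsGreedySelection o.projSqDist (α * o.N / 3) (8.8 * d) (35.2 * d) o.sel) :
    Maximal (o.IsClusterSet α) o.returned := by
  obtain ⟨h1, h2, h3⟩ := h
  have hmem : ∀ i, i ∈ o.returned ↔ o.sel i = true := fun i => by simp [returned]
  refine ⟨fun i hi => ⟨h1 i ((hmem i).1 hi), fun j hj hij =>
    h2 i j ((hmem i).1 hi) ((hmem j).1 hj) hij⟩, fun L hL hle i hi => ?_⟩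
  by_contra hni
  rw [hmem, Bool.not_eq_true] at hni
  obtain ⟨j, hj, hij⟩ := h3 i (hL i hi).1 hni
  have hne : j ≠ i := by
    rintro rfl
    simp [hj] at hni
  exact absurd ((hL i hi).2 j (hle ((hmem j).2 hj)) hne) (not_lt.2 hij)

theorem card_le_of_isClusterSet (hα : 0 < α) (hN : 0 < o.N) {L : Finset (Fin o.N)}
    (hL : o.IsClusterSet α L) : (#L : ℝ) ≤ 3 / α := by
  classical
  have hdisj : (L : Set (Fin o.N)).PairwiseDisjoint
      fun i => univ.filter fun j => o.projSqDist i j ≤ 8.8 * d := by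
    intro i hi j hj hij
    refine disjoint_left.2 fun k hk hk' => ?_
    simp only [mem_filter, mem_univ, true_and] at hk hk'
    have hlt := (hL i hi).2 j hj hij.symm
    rw [projSqDist_eq] at hk hk' hlt
    have hle : ∑ k, (Matrix.mulVec o.G.transpose (o.pts i) k -
        Matrix.mulVec o.G.transpose (o.pts j) k) ^ 2 ≤
        ∑ l, (2 * (Matrix.mulVec o.G.transpose (o.pts i) l -
        Matrix.mulVec o.G.transpose (o.pts k) l) ^ 2 + 2 * (Matrix.mulVec o.G.transpose (o.pts j) l -
        Matrix.mulVec o.G.transpose (o.pts k) l) ^ 2) := by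
      refine sum_le_sum fun l _ => ?_
      generalize Matrix.mulVec o.G.transpose (o.pts i) l = a
      generalize Matrix.mulVec o.G.transpose (o.pts j) l = b
      generalize Matrix.mulVec o.G.transpose (o.pts k) l = c
      -- The parallelogram law: the difference of the two sides is exactly this square. The
      -- resulting factor `4` is why the radii are `8.8` and `35.2`.
      nlinarith [sq_nonneg (a - c + (b - c))]
    rw [sum_add_distrib, ← mul_sum, ← mul_sum] at hle
    linarith
  have hcard := card_biUnion hdisj
  have h1 : ∑ i ∈ L, #(univ.filter fun j => o.projSqDist i j ≤ 8.8 * d) ≤ o.N := by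
    rw [← hcard]
    exact (card_le_univ _).trans (by simp)
  have h2 : #L * (α * o.N / 3) ≤ (o.N : ℝ) := by
    calc #L * (α * o.N / 3) = ∑ _i ∈ L, α * o.N / 3 := by simp
      _ ≤ ∑ i ∈ L, (#(univ.filter fun j => o.projSqDist i j ≤ 8.8 * d) : ℝ) :=
        sum_le_sum fun i hi => (hL i hi).1
      _ ≤ o.N := by exact_mod_cast h1
  have hN' : (0 : ℝ) < o.N := by exact_mod_cast hN
  rw [le_div_iff₀ hα]
  refine le_of_mul_le_mul_right ?_ hN'
  linarith

end Outcome

/-! ### Lower tail of the number of successes in independent uniform trials -/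

/-- If at least a fraction `α / 2` of the elements of `Ω` is good, then among `N` independent uniform
elements fewer than `α N / 3` are good with probability at most `exp (-α N / 36)`. -/
theorem card_few_successes_le {Ω : Type*} [Fintype Ω] (P : Ω → Prop) [DecidablePred P] {α : ℝ}
    (hα : 0 ≤ α) (hP : α / 2 * Fintype.card Ω ≤ #{ω | P ω}) (N : ℕ) :
    (#{v : Fin N → Ω | (#{i | P (v i)} : ℝ) < α * N / 3} : ℝ) ≤
      Real.exp (-(α * N / 36)) * Fintype.card (Fin N → Ω) := by
  -- Chernoff bound with weight `2 / 3` per success. One trial contributes at most `1 - α / 6 ≤ exp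
  -- (-α / 6)`, the threshold `α N / 3` costs `exp (5 α N / 36)`, and `5 / 36 - 1 / 6 = -1 / 36`.
  have hlog : Real.log (3 / 2) ≤ 5 / 12 := by
    rw [Real.log_le_iff_le_exp (by norm_num)]
    have h := Real.sum_le_exp_of_nonneg (show (0 : ℝ) ≤ 5 / 12 by norm_num) 5
    refine le_trans ?_ h
    norm_num [sum_range_succ, Nat.factorial]
  have hw : ∑ ω, (if P ω then (2 / 3 : ℝ) else 1) ≤ Real.exp (-(α / 6)) * Fintype.card Ω := by
    have h1 : ∑ ω, (if P ω then (2 / 3 : ℝ) else 1) = Fintype.card Ω - #{ω | P ω} / 3 := by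
      have : ∀ ω, (if P ω then (2 / 3 : ℝ) else 1) = 1 - (if P ω then 1 else 0) / 3 := by
        intro ω; split_ifs <;> norm_num
      simp [this, sum_sub_distrib, ← sum_div]
    have h2 := Real.add_one_le_exp (-(α / 6))
    have h3 : (0 : ℝ) ≤ Fintype.card Ω := by positivity
    rw [h1]
    nlinarith
  have hprod : ∀ v : Fin N → Ω, (#{i | P (v i)} : ℝ) < α * N / 3 →
      1 ≤ Real.exp (α * N / 3 * (5 / 12)) * ∏ i, (if P (v i) then (2 / 3 : ℝ) else 1) := by
    intro v hv
    have h1 : ∏ i, (if P (v i) then (2 / 3 : ℝ) else 1) =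
        Real.exp (-(#{i | P (v i)} * Real.log (3 / 2))) := by
      rw [prod_ite, prod_const, prod_const_one, mul_one, ← mul_neg, Real.exp_nat_mul,
        Real.exp_neg, Real.exp_log (by norm_num), inv_div]
    rw [h1, ← Real.exp_add]
    refine Real.one_le_exp ?_
    have h2 : (0 : ℝ) ≤ Real.log (3 / 2) := Real.log_nonneg (by norm_num)
    have h3 : (0 : ℝ) ≤ α * N / 3 := by positivity
    nlinarith
  calc (#{v : Fin N → Ω | (#{i | P (v i)} : ℝ) < α * N / 3} : ℝ)
      = ∑ v : Fin N → Ω, (if (#{i | P (v i)} : ℝ) < α * N / 3 then 1 else 0) := by simp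
    _ ≤ ∑ v : Fin N → Ω, Real.exp (α * N / 3 * (5 / 12)) *
          ∏ i, (if P (v i) then (2 / 3 : ℝ) else 1) := by
        refine sum_le_sum fun v _ => ?_
        split_ifs with h
        · exact hprod v h
        · exact mul_nonneg (Real.exp_nonneg _) (prod_nonneg fun i _ => by split_ifs <;> norm_num)
    _ = Real.exp (α * N / 3 * (5 / 12)) * (∑ ω, (if P ω then (2 / 3 : ℝ) else 1)) ^ N := by
        rw [← mul_sum, Fintype.sum_pow]
    _ ≤ Real.exp (α * N / 3 * (5 / 12)) * (Real.exp (-(α / 6)) * Fintype.card Ω) ^ N := by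
        gcongr
    _ = Real.exp (-(α * N / 36)) * Fintype.card (Fin N → Ω) := by
        rw [mul_pow, ← Real.exp_nat_mul, ← mul_assoc, ← Real.exp_add, Fintype.card_fun,
          Fintype.card_fin]
        push_cast
        ring_nf

/-! ### Rademacher sums and random sign matrices -/

/-- The sign that belongs to a Boolean. -/
def boolSign (b : Bool) : ℝ := if b then 1 else -1

/-- The value of the linear form with coefficients `x` at a vector of signs. -/
def signSum {d : ℕ} (x : Fin d → ℝ) (b : Fin d → Bool) : ℝ := ∑ j, boolSign (b j) * x j

variable {d : ℕ}

theorem sum_exp_signSum (x : Fin d → ℝ) (t : ℝ) :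
    ∑ b, Real.exp (t * signSum x b) = ∏ j, (2 * Real.cosh (t * x j)) := by
  have h : ∀ j, 2 * Real.cosh (t * x j) = ∑ b, Real.exp (t * (boolSign b * x j)) := by
    intro j
    simp only [Fintype.sum_bool, boolSign, Real.cosh_eq, if_true, Bool.false_eq_true, if_false]
    ring_nf
  simp_rw [h]
  rw [Fintype.prod_sum]
  simp_rw [← Real.exp_sum, ← mul_sum]
  rfl

/-- Rademacher sums are subgaussian, because `cosh s ≤ exp (s ^ 2 / 2)` in each coordinate. -/
theorem sum_exp_signSum_le {x : Fin d → ℝ} (hx : ∑ j, x j ^ 2 = 1) (t : ℝ) :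
    ∑ b, Real.exp (t * signSum x b) ≤ 2 ^ d * Real.exp (t ^ 2 / 2) := by
  rw [sum_exp_signSum, prod_mul_distrib, prod_const, card_univ, Fintype.card_fin]
  gcongr
  calc ∏ j, Real.cosh (t * x j) ≤ ∏ j, Real.exp ((t * x j) ^ 2 / 2) :=
        prod_le_prod (fun j _ => (Real.cosh_pos _).le) fun j _ => Real.cosh_le_exp_half_sq _
    _ = Real.exp (t ^ 2 / 2) := by
        rw [← Real.exp_sum]
        congr 1
        simp_rw [mul_pow, ← sum_div, ← mul_sum]
        rw [hx, mul_one]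

/-- Writes `exp (a ^ 2)` as a Gaussian average of exponentials linear in `a`, which transfers bounds
from linear to quadratic exponents. -/
theorem integral_exp_neg_sq_add_mul (a : ℝ) :
    MeasureTheory.Integrable (fun t : ℝ => Real.exp (-t ^ 2 + 2 * a * t)) ∧
      ∫ t : ℝ, Real.exp (-t ^ 2 + 2 * a * t) = Real.sqrt Real.pi * Real.exp (a ^ 2) := by
  have h : (fun t : ℝ => Real.exp (-t ^ 2 + 2 * a * t)) =
      fun t => Real.exp (a ^ 2) * Real.exp (-1 * (t - a) ^ 2) := by
    funext t
    rw [← Real.exp_add]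
    congr 1
    ring
  rw [h]
  constructor
  · exact ((integrable_exp_neg_mul_sq one_pos).comp_sub_right a).const_mul _
  · rw [MeasureTheory.integral_const_mul,
      MeasureTheory.integral_sub_right_eq_self (fun t : ℝ => Real.exp (-1 * t ^ 2)) a,
      integral_gaussian, div_one, mul_comm]

/-- After linearising the square by a Gaussian integral, the subgaussian bound applies under the
integral and leaves the moment generating function of a squared standard Gaussian. -/
theorem sum_exp_mul_signSum_sq_le {x : Fin d → ℝ} (hx : ∑ j, x j ^ 2 = 1) {l : ℝ} (hl0 : 0 ≤ l)
    (hl : l < 1 / 2) :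
    ∑ b, Real.exp (l * signSum x b ^ 2) ≤ 2 ^ d * Real.sqrt (1 / (1 - 2 * l)) := by
  have hpi : 0 < Real.sqrt Real.pi := Real.sqrt_pos.2 Real.pi_pos
  have h1 : ∀ b, Real.sqrt Real.pi * Real.exp (l * signSum x b ^ 2) =
      ∫ t : ℝ, Real.exp (-t ^ 2 + 2 * (Real.sqrt l * signSum x b) * t) := by
    intro b
    rw [(integral_exp_neg_sq_add_mul _).2, mul_pow, Real.sq_sqrt hl0]
  have h2 : ∫ t : ℝ, Real.exp (-(1 - 2 * l) * t ^ 2) =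
      Real.sqrt Real.pi * Real.sqrt (1 / (1 - 2 * l)) := by
    rw [integral_gaussian, ← Real.sqrt_mul Real.pi_pos.le, mul_one_div]
  refine le_of_mul_le_mul_left ?_ hpi
  calc Real.sqrt Real.pi * ∑ b, Real.exp (l * signSum x b ^ 2)
      = ∫ t : ℝ, ∑ b, Real.exp (-t ^ 2 + 2 * (Real.sqrt l * signSum x b) * t) := by
        rw [mul_sum, MeasureTheory.integral_finsetSum]
        · exact sum_congr rfl fun b _ => h1 b
        · exact fun b _ => (integral_exp_neg_sq_add_mul _).1
    _ ≤ ∫ t : ℝ, 2 ^ d * Real.exp (-(1 - 2 * l) * t ^ 2) := by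
        refine MeasureTheory.integral_mono
          (MeasureTheory.integrable_finsetSum _ fun b _ => (integral_exp_neg_sq_add_mul _).1)
          ((integrable_exp_neg_mul_sq (by linarith)).const_mul _) fun t => ?_
        have h3 := sum_exp_signSum_le hx (2 * Real.sqrt l * t)
        calc ∑ b, Real.exp (-t ^ 2 + 2 * (Real.sqrt l * signSum x b) * t)
            = Real.exp (-t ^ 2) * ∑ b, Real.exp (2 * Real.sqrt l * t * signSum x b) := by
              rw [mul_sum]
              refine sum_congr rfl fun b _ => ?_
              rw [← Real.exp_add]
              congr 1
              ring
          _ ≤ Real.exp (-t ^ 2) * (2 ^ d * Real.exp ((2 * Real.sqrt l * t) ^ 2 / 2)) := by gcongr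
          _ = 2 ^ d * Real.exp (-(1 - 2 * l) * t ^ 2) := by
              rw [mul_left_comm, ← Real.exp_add, mul_pow, mul_pow, Real.sq_sqrt hl0]
              congr 2
              ring
    _ = Real.sqrt Real.pi * (2 ^ d * Real.sqrt (1 / (1 - 2 * l))) := by
        rw [MeasureTheory.integral_const_mul, h2, mul_left_comm]

theorem sum_signSum_sq (x : Fin d → ℝ) : ∑ b, signSum x b ^ 2 = 2 ^ d * ∑ j, x j ^ 2 := by
  induction d with
  | zero => simp [signSum]
  | succ d ih =>
    rw [← (Fin.consEquiv fun _ : Fin (d + 1) => Bool).sum_comp, Fintype.sum_prod_type,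
      Fintype.sum_bool, ← sum_add_distrib]
    have h : ∀ b : Fin d → Bool,
        signSum x ((Fin.consEquiv fun _ : Fin (d + 1) => Bool) (true, b)) ^ 2 +
          signSum x ((Fin.consEquiv fun _ : Fin (d + 1) => Bool) (false, b)) ^ 2 =
        2 * x 0 ^ 2 + 2 * signSum (fun j => x j.succ) b ^ 2 := by
      intro b
      simp only [signSum, Fin.sum_univ_succ, Fin.consEquiv, Equiv.coe_fn_mk, Fin.cons_zero,
        Fin.cons_succ, boolSign]
      simp only [if_true, Bool.false_eq_true, if_false]
      ring
    simp_rw [h]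
    rw [sum_add_distrib, ← mul_sum univ (fun b => signSum _ b ^ 2), ih, Fin.sum_univ_succ]
    simp
    ring

/-- Second-order expansion of `exp (-y / 46)` for the lower tail. The mean of `y` is `1`, and the
quadratic term is controlled by the mean of `exp (y / 4)`, at most `√2 ≤ 23 / 16`. Altogether `1 - 1
/ 46 + (4 / 529) * (23 / 16) = 1 - 1 / 92`. -/
theorem sum_exp_neg_signSum_sq_le {x : Fin d → ℝ} (hx : ∑ j, x j ^ 2 = 1) :
    ∑ b, Real.exp (-(1 / 46) * signSum x b ^ 2) ≤ 2 ^ d * Real.exp (-(1 / 92)) := by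
  have hs : Real.sqrt (1 / (1 - 2 * (1 / 4))) ≤ 23 / 16 := by
    rw [Real.sqrt_le_left (by norm_num)]
    norm_num
  have h1 := (sum_exp_mul_signSum_sq_le hx (l := 1 / 4) (by norm_num) (by norm_num)).trans
    (mul_le_mul_of_nonneg_left hs (by positivity))
  -- The coefficient `4 / 529` is `32 / (2 * 46 ^ 2)`, from `y ^ 2 ≤ 32 * exp (y / 4)`.
  have hpt : ∀ b, Real.exp (-(1 / 46) * signSum x b ^ 2) ≤
      1 - 1 / 46 * signSum x b ^ 2 + 4 / 529 * Real.exp (1 / 4 * signSum x b ^ 2) := by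
    intro b
    set y := signSum x b ^ 2
    have hy : 0 ≤ y := sq_nonneg _
    have h2 := Real.quadratic_le_exp_of_nonneg (show 0 ≤ 1 / 4 * y by positivity)
    have h3 : Real.exp (-(1 / 46) * y) ≤ 1 - 1 / 46 * y + (1 / 46 * y) ^ 2 / 2 := by
      set t := 1 / 46 * y with ht
      have ht0 : 0 ≤ t := by positivity
      have h4 := Real.quadratic_le_exp_of_nonneg ht0
      have h5 : 0 < 1 - t + t ^ 2 / 2 := by nlinarith [sq_nonneg (t - 1)]
      -- Uses `(1 - t + t ^ 2 / 2) * (1 + t + t ^ 2 / 2) = 1 + t ^ 4 / 4`.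
      rw [neg_mul, Real.exp_neg, inv_le_iff_one_le_mul₀ (Real.exp_pos _)]
      nlinarith [mul_le_mul_of_nonneg_left h4 h5.le, sq_nonneg (t ^ 2)]
    nlinarith
  calc _ ≤ ∑ b, (1 - 1 / 46 * signSum x b ^ 2 + 4 / 529 * Real.exp (1 / 4 * signSum x b ^ 2)) :=
        sum_le_sum fun b _ => hpt b
    _ = 2 ^ d - 1 / 46 * 2 ^ d + 4 / 529 * ∑ b, Real.exp (1 / 4 * signSum x b ^ 2) := by
        rw [sum_add_distrib, sum_sub_distrib, ← mul_sum, ← mul_sum, sum_signSum_sq, hx]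
        simp
    _ ≤ 2 ^ d * (1 - 1 / 92) := by linarith
    _ ≤ _ := by
        gcongr
        have := Real.add_one_le_exp (-(1 / 92) : ℝ)
        linarith

/-- Exponential Markov inequality for the sum of `c` independent copies of `f`. -/
theorem card_sum_gt_le {Ω : Type*} [Fintype Ω] (f : Ω → ℝ) (s M : ℝ)
    (h : ∑ ω, Real.exp (f ω) ≤ Fintype.card Ω * Real.exp M) (c : ℕ) :
    (#{v : Fin c → Ω | c * s < ∑ k, f (v k)} : ℝ) ≤
      Real.exp (c * (M - s)) * Fintype.card (Fin c → Ω) := by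
  calc (#{v : Fin c → Ω | c * s < ∑ k, f (v k)} : ℝ)
      = ∑ v : Fin c → Ω, (if c * s < ∑ k, f (v k) then 1 else 0) := by simp
    _ ≤ ∑ v : Fin c → Ω, Real.exp (-(c * s)) * ∏ k, Real.exp (f (v k)) := by
        refine sum_le_sum fun v _ => ?_
        rw [← Real.exp_sum, ← Real.exp_add]
        split_ifs with hv
        · exact Real.one_le_exp (by linarith)
        · positivity
    _ = Real.exp (-(c * s)) * (∑ ω, Real.exp (f ω)) ^ c := by
        rw [← mul_sum, Fintype.sum_pow]
    _ ≤ Real.exp (-(c * s)) * (Fintype.card Ω * Real.exp M) ^ c := by gcongr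
    _ = Real.exp (c * (M - s)) * Fintype.card (Fin c → Ω) := by
        rw [mul_pow, ← Real.exp_nat_mul, mul_left_comm, ← Real.exp_add, Fintype.card_fun,
          Fintype.card_fin, mul_comm]
        push_cast
        congr 2
        ring

/-- The random matrix with entries `± 1 / √c` that belongs to an array of Booleans. -/
noncomputable def boolMatrix {d c : ℕ} (b : Fin d → Fin c → Bool) : Matrix (Fin d) (Fin c) ℝ :=
  fun j k => if b j k then 1 / Real.sqrt c else 0 - 1 / Real.sqrt c

theorem sum_mulVec_boolMatrix_sq {c : ℕ} (hc : 0 < c) (b : Fin d → Fin c → Bool)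
    (x : Fin d → ℝ) :
    c * ∑ k, Matrix.mulVec (boolMatrix b).transpose x k ^ 2 =
      ∑ k, signSum x (fun j => b j k) ^ 2 := by
  rw [mul_sum]
  refine sum_congr rfl fun k _ => ?_
  have h : Matrix.mulVec (boolMatrix b).transpose x k =
      1 / Real.sqrt c * signSum x (fun j => b j k) := by
    simp only [signSum, mul_sum, Matrix.mulVec, dotProduct]
    refine sum_congr rfl fun j _ => ?_
    simp only [Matrix.transpose_apply, boolMatrix, boolSign]
    split_ifs <;> ring
  have hc' : (0 : ℝ) < c := by exact_mod_cast hc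
  rw [h, mul_pow, div_pow, Real.sq_sqrt hc'.le]
  field_simp

/-- The tail bounds treat the columns as independent samples, while the arrays are indexed by rows
first. -/
theorem card_piComm_filter {ι κ : Type*} [Fintype ι] [Fintype κ] [DecidableEq ι] [DecidableEq κ]
    (P : (κ → ι → Bool) → Prop) [DecidablePred P] :
    #{b : ι → κ → Bool | P fun k j => b j k} = #{v : κ → ι → Bool | P v} :=
  card_equiv (Equiv.piComm _) fun b => by simp [Equiv.piComm]

/-- The projection by a random sign matrix distorts the length of `x` substantially. -/
def IsDistorted {d c : ℕ} (x : Fin d → ℝ) (b : Fin d → Fin c → Bool) : Prop :=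
  1.1 * ∑ j, x j ^ 2 < ∑ k, Matrix.mulVec (boolMatrix b).transpose x k ^ 2 ∨
    ∑ k, Matrix.mulVec (boolMatrix b).transpose x k ^ 2 < 1 / 4 * ∑ j, x j ^ 2

-- Exponential Markov in both directions. Upper tail: weight `1 / 22`, threshold `1.1 / 22 = 1 /
-- 20`, rate `1 / 20 - 6 / 125 = 1 / 500`. Lower tail: weight `1 / 46`, threshold `(1 / 4) / 46 = 1
-- / 184`, with the better rate `1 / 184`.
open Classical in
theorem card_isDistorted_le_of_norm_one {c : ℕ} (hc : 0 < c) {x : Fin d → ℝ}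
    (hx : ∑ j, x j ^ 2 = 1) :
    (#{b : Fin d → Fin c → Bool | IsDistorted x b} : ℝ) ≤
      2 * Real.exp (-(c / 500)) * Fintype.card (Fin d → Fin c → Bool) := by
  have hcard : (Fintype.card (Fin c → Fin d → Bool) : ℝ) =
      Fintype.card (Fin d → Fin c → Bool) := by
    exact_mod_cast Fintype.card_congr (Equiv.piComm _)
  have hcard' : (Fintype.card (Fin d → Bool) : ℝ) = 2 ^ d := by simp
  have hc' : (0 : ℝ) < c := by exact_mod_cast hc
  have hsqrt : Real.sqrt (1 / (1 - 2 * (1 / 22))) ≤ Real.exp (6 / 125) := by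
    rw [Real.sqrt_le_left (Real.exp_nonneg _), ← Real.exp_nat_mul]
    have := Real.quadratic_le_exp_of_nonneg (show (0 : ℝ) ≤ (2 : ℕ) * (6 / 125) by norm_num)
    refine le_trans ?_ this
    norm_num
  have h1 := card_sum_gt_le (fun b : Fin d → Bool => 1 / 22 * signSum x b ^ 2) (1 / 20) (6 / 125)
    ((sum_exp_mul_signSum_sq_le hx (by norm_num) (by norm_num)).trans
      (by rw [hcard']; gcongr)) c
  have h2 := card_sum_gt_le (fun b : Fin d → Bool => -(1 / 46) * signSum x b ^ 2)
    (-(1 / 184)) (-(1 / 92)) ((sum_exp_neg_signSum_sq_le hx).trans (by rw [hcard'])) c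
  have hsub : (univ.filter fun b : Fin d → Fin c → Bool => IsDistorted x b) ⊆
      (univ.filter fun b : Fin d → Fin c → Bool =>
        (fun v : Fin c → Fin d → Bool => (c : ℝ) * (1 / 20) < ∑ k, 1 / 22 * signSum x (v k) ^ 2)
          fun k j => b j k) ∪
      (univ.filter fun b : Fin d → Fin c → Bool =>
        (fun v : Fin c → Fin d → Bool => (c : ℝ) * (-(1 / 184)) < ∑ k, -(1 / 46) * signSum x (v k) ^ 2)
          fun k j => b j k) := by
    intro b hb
    simp only [mem_filter, mem_univ, true_and, mem_union, IsDistorted, hx] at hb ⊢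
    rw [← mul_sum, ← mul_sum, ← sum_mulVec_boolMatrix_sq hc]
    rcases hb with hb | hb
    · left
      nlinarith
    · right
      nlinarith
  have h3 : (#{b : Fin d → Fin c → Bool | IsDistorted x b} : ℝ) ≤ _ :=
    Nat.cast_le.2 ((card_le_card hsub).trans (card_union_le _ _))
  rw [card_piComm_filter fun v : Fin c → Fin d → Bool =>
      (c : ℝ) * (1 / 20) < ∑ k, 1 / 22 * signSum x (v k) ^ 2,
    card_piComm_filter fun v : Fin c → Fin d → Bool =>
      (c : ℝ) * (-(1 / 184)) < ∑ k, -(1 / 46) * signSum x (v k) ^ 2] at h3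
  push_cast at h3
  refine h3.trans ((add_le_add h1 h2).trans ?_)
  rw [hcard, ← add_mul, two_mul]
  gcongr <;> linarith

open Classical in
/-- A random sign matrix distorts the length of a fixed vector with exponentially small
probability. -/
theorem card_isDistorted_le {c : ℕ} (hc : 0 < c) (x : Fin d → ℝ) :
    (#{b : Fin d → Fin c → Bool | IsDistorted x b} : ℝ) ≤
      2 * Real.exp (-(c / 500)) * Fintype.card (Fin d → Fin c → Bool) := by
  have h0 : 0 ≤ ∑ j, x j ^ 2 := sum_nonneg fun j _ => sq_nonneg _
  rcases h0.eq_or_lt with h | h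
  · have hx : x = 0 := by
      funext j
      have := (sum_eq_zero_iff_of_nonneg fun j _ => sq_nonneg (x j)).1 h.symm j (mem_univ j)
      exact pow_eq_zero_iff two_ne_zero |>.1 this
    have hempty : ∀ b : Fin d → Fin c → Bool, ¬ IsDistorted x b := by
      intro b
      simp [IsDistorted, hx]
    simp only [hempty, filter_false, card_empty, Nat.cast_zero]
    positivity
  · set r := Real.sqrt (∑ j, x j ^ 2) with hr
    have hr2 : r ^ 2 = ∑ j, x j ^ 2 := Real.sq_sqrt h0
    have hr0 : 0 < r := Real.sqrt_pos.2 h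
    have hy : ∑ j, (r⁻¹ • x) j ^ 2 = 1 := by
      simp only [Pi.smul_apply, smul_eq_mul, mul_pow, ← mul_sum, ← hr2]
      field_simp
    -- Distortion is invariant under scaling, which reduces to unit vectors.
    have heq : ∀ b : Fin d → Fin c → Bool, IsDistorted x b ↔ IsDistorted (r⁻¹ • x) b := by
      intro b
      have hx : x = r • (r⁻¹ • x) := by rw [smul_smul, mul_inv_cancel₀ hr0.ne', one_smul]
      generalize r⁻¹ • x = y at hx
      rw [hx]
      simp only [IsDistorted, Matrix.mulVec_smul, Pi.smul_apply, smul_eq_mul, mul_pow, ← mul_sum]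
      have : 0 < r ^ 2 := by positivity
      rw [mul_left_comm (1.1 : ℝ), mul_left_comm (1 / 4 : ℝ), mul_lt_mul_iff_right₀ this,
        mul_lt_mul_iff_right₀ this]
    simp only [heq]
    exact card_isDistorted_le_of_norm_one hc hy

namespace Prog

variable {n d : ℕ} {X : Fin n → EuclideanSpace ℝ (Fin d)} {A : Type}

/-! ### The law of the random choices -/

theorem isUniform_samplePoint [NeZero n] :
    IsUniform X samplePoint fun i => (X i).ofLp := by
  intro f
  change _ * ∑ i, (tabulate d fun j => read i j ret).expect X f = _
  congr 1
  refine sum_congr rfl fun i _ => (ensures_tabulate fun j => ensures_read i j).expect_eq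
    fun v hv => congrArg f (funext hv)

theorem isUniform_signMatrix (c : ℕ) :
    IsUniform X (signMatrix c) fun b : Fin d → Fin c → Bool => boolMatrix b := by
  have h : ∀ pos neg : ℝ, IsUniform X (coin ret >>= fun b => Pure.pure (if b then pos else neg))
      fun b : Bool => if b = true then pos else neg := fun pos neg f => by
    rw [expect_bind]
    rfl
  have h2 : ∀ f, (signMatrix c).expect X f =
      (tabulate d fun _ => tabulate c fun _ =>
        coin ret >>= fun b => Pure.pure (if b then ((1 : ℚ) : ℝ) / Real.sqrt c
          else ((0 : ℚ) : ℝ) - ((1 : ℚ) : ℝ) / Real.sqrt c)).expect X f := fun f => rfl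
  intro f
  rw [h2, isUniform_tabulate (isUniform_tabulate (h _ _) c) d]
  -- `boolMatrix` keeps the negative entry as `0 - 1 / √c`, the form the program computes.
  simp only [Rat.cast_one, Rat.cast_zero]
  rfl

/-- The nested averages express that the sample and the matrix are independent, so the matrix can be
analysed for a fixed sample. -/
theorem expect_samplePostProcess [NeZero n] (K : ℕ) (α δ : ℝ) {N c : ℕ}
    (hN : ⌈36 * Real.log (2 / δ) / α⌉₊ = N) (hc : ⌈K * Real.log (1 / (α * δ))⌉₊ = c)
    (f : Outcome ℝ d → ENNReal) :
    (samplePostProcess K α δ).expect X f =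
      (Fintype.card (Fin N → Fin n) : ENNReal)⁻¹ * ∑ ι : Fin N → Fin n,
        (Fintype.card (Fin d → Fin c → Bool) : ENNReal)⁻¹ * ∑ b : Fin d → Fin c → Bool,
          (clusterPhase α N c (fun i => (X (ι i)).ofLp) (boolMatrix b)).expect X f := by
  rw [samplePostProcess_eq, expect_bind, (ensures_sampleCount α δ).expect_eq fun a h => by rw [h, hN],
    expect_bind, isUniform_tabulate isUniform_samplePoint]
  congr 1
  refine sum_congr rfl fun ι _ => ?_
  rw [expect_bind, (ensures_sketchDim K α δ).expect_eq fun a h => by rw [h, hc], expect_bind,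
    isUniform_signMatrix]

end Prog

/-! ### Inliers -/

/-- The trace bounds the mean of `‖X i - μ‖ ^ 2` over `S` by `d`; Markov's inequality at `2 d`
discards at most half of `S`. -/
theorem HasInliers.card_near_ge {n d : ℕ} {X : Fin n → EuclideanSpace ℝ (Fin d)} {α : ℝ}
    {μ : EuclideanSpace ℝ (Fin d)} (h : HasInliers X α μ) (hα : 0 < α) (hn : 0 < n) (hd : 0 < d) :
    α / 2 * n ≤ (#{i | ‖X i - μ‖ ^ 2 ≤ 2 * d} : ℝ) := by
  obtain ⟨S, hS, hpsd⟩ := h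
  have hS0 : (0 : ℝ) < #S := lt_of_lt_of_le (by positivity) hS
  have hd' : (0 : ℝ) < d := by exact_mod_cast hd
  have htr := hpsd.trace_nonneg
  rw [Matrix.trace_sub, Matrix.trace_one, Matrix.trace_smul, Matrix.trace_sum, Fintype.card_fin,
    smul_eq_mul] at htr
  have hnorm : ∀ i, (Matrix.vecMulVec (X i - μ).ofLp (X i - μ).ofLp).trace = ‖X i - μ‖ ^ 2 := by
    intro i
    rw [Matrix.trace_vecMulVec, EuclideanSpace.real_norm_sq_eq]
    simp [dotProduct, sq]
  simp_rw [hnorm] at htr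
  have hsum : ∑ i ∈ S, ‖X i - μ‖ ^ 2 ≤ d * #S := by
    rw [← div_le_iff₀ hS0, div_eq_inv_mul]
    linarith
  have hbad : #(S.filter fun i => ¬ ‖X i - μ‖ ^ 2 ≤ 2 * d) * (2 * d : ℝ) ≤
      ∑ i ∈ S, ‖X i - μ‖ ^ 2 := by
    calc #(S.filter fun i => ¬ ‖X i - μ‖ ^ 2 ≤ 2 * d) * (2 * d : ℝ)
        = ∑ _i ∈ S.filter fun i => ¬ ‖X i - μ‖ ^ 2 ≤ 2 * d, (2 * d : ℝ) := by simp
      _ ≤ ∑ i ∈ S.filter fun i => ¬ ‖X i - μ‖ ^ 2 ≤ 2 * d, ‖X i - μ‖ ^ 2 :=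
        sum_le_sum fun i hi => (not_le.1 (mem_filter.1 hi).2).le
      _ ≤ ∑ i ∈ S, ‖X i - μ‖ ^ 2 :=
        sum_le_sum_of_subset_of_nonneg (filter_subset _ _) fun _ _ _ => sq_nonneg _
  have hsplit : (#(S.filter fun i => ‖X i - μ‖ ^ 2 ≤ 2 * d) : ℝ) +
      #(S.filter fun i => ¬ ‖X i - μ‖ ^ 2 ≤ 2 * d) = #S := by
    exact_mod_cast card_filter_add_card_filter_not _
  have hle : (#(S.filter fun i => ‖X i - μ‖ ^ 2 ≤ 2 * d) : ℝ) ≤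
      #{i | ‖X i - μ‖ ^ 2 ≤ 2 * d} := by
    exact_mod_cast card_le_card (filter_subset_filter _ (subset_univ _))
  have hbad' : 2 * (#(S.filter fun i => ¬ ‖X i - μ‖ ^ 2 ≤ 2 * d) : ℝ) ≤ #S := by
    refine le_of_mul_le_mul_left ?_ hd'
    linarith
  linarith

/-! ### Correctness under the good event -/

theorem Outcome.exists_norm_sub_le {d : ℕ} {o : Outcome ℝ d} {α : ℝ} {μ : EuclideanSpace ℝ (Fin d)}
    (hα : 0 < α) (hN : 0 < o.N)
    (hnear : α * o.N / 3 ≤ (#{i | ‖WithLp.toLp 2 (o.pts i) - μ‖ ^ 2 ≤ 2 * d} : ℝ))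
    (hup : ∀ i j, o.projSqDist i j ≤ 1.1 * ‖WithLp.toLp 2 (o.pts i) - WithLp.toLp 2 (o.pts j)‖ ^ 2)
    (hlow : ∀ i j,
      1 / 4 * ‖WithLp.toLp 2 (o.pts i) - WithLp.toLp 2 (o.pts j)‖ ^ 2 ≤ o.projSqDist i j)
    {L : Finset (Fin o.N)} (hL : Maximal (o.IsClusterSet α) L) :
    ∃ i ∈ L, ‖WithLp.toLp 2 (o.pts i) - μ‖ ≤ 14 * Real.sqrt d := by
  classical
  have hN' : (0 : ℝ) < o.N := by exact_mod_cast hN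
  have hs : Real.sqrt d ^ 2 = d := Real.sq_sqrt (Nat.cast_nonneg d)
  have hs0 : 0 ≤ Real.sqrt d := Real.sqrt_nonneg _
  have hnorm : ∀ i, ‖WithLp.toLp 2 (o.pts i) - μ‖ ^ 2 ≤ 2 * d →
      ‖WithLp.toLp 2 (o.pts i) - μ‖ ≤ 3 / 2 * Real.sqrt d := fun i hi =>
    abs_le_of_sq_le_sq' (by rw [mul_pow, hs]; nlinarith [Nat.cast_nonneg (α := ℝ) d])
      (by positivity) |>.2
  obtain ⟨i, hi⟩ : (univ.filter fun i => ‖WithLp.toLp 2 (o.pts i) - μ‖ ^ 2 ≤ 2 * d).Nonempty := by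
    rw [← card_pos]
    have : (0 : ℝ) < α * o.N / 3 := by positivity
    exact_mod_cast this.trans_le hnear
  have hi' : ‖WithLp.toLp 2 (o.pts i) - μ‖ ^ 2 ≤ 2 * d := (mem_filter.1 hi).2
  by_cases hiL : i ∈ L
  · exact ⟨i, hiL, (hnorm i hi').trans (by linarith)⟩
  have hdense : α * o.N / 3 ≤ (#{j | o.projSqDist i j ≤ 8.8 * d} : ℝ) := by
    refine hnear.trans (Nat.cast_le.2 (card_le_card fun j hj => ?_))
    simp only [mem_filter, mem_univ, true_and] at hj ⊢
    refine (hup i j).trans ?_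
    have h1 := norm_sub_le_norm_sub_add_norm_sub (WithLp.toLp 2 (o.pts i)) μ
      (WithLp.toLp 2 (o.pts j))
    rw [norm_sub_rev μ] at h1
    have h2 : ‖WithLp.toLp 2 (o.pts i) - WithLp.toLp 2 (o.pts j)‖ ^ 2 ≤
        (‖WithLp.toLp 2 (o.pts i) - μ‖ + ‖WithLp.toLp 2 (o.pts j) - μ‖) ^ 2 := by gcongr
    -- Two near points have squared distance at most `(2 * √(2 d)) ^ 2 = 8 d`, and `1.1 * 8 = 8.8`.
    nlinarith [sq_nonneg (‖WithLp.toLp 2 (o.pts i) - μ‖ - ‖WithLp.toLp 2 (o.pts j) - μ‖)]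
  have hex : ∃ j ∈ L, o.projSqDist i j ≤ 35.2 * d := by
    by_contra! hfar
    -- Otherwise the dense point `i` could be added to `L`, against maximality.
    refine hiL (hL.2 (y := insert i L) (fun k hk => ?_) (subset_insert i L) (mem_insert_self i L))
    rcases mem_insert.1 hk with rfl | hk
    · refine ⟨hdense, fun j hj hne => hfar j ((mem_insert.1 hj).resolve_left hne)⟩
    · refine ⟨(hL.1 k hk).1, fun j hj hne => ?_⟩
      rcases mem_insert.1 hj with h | hj
      · rw [h, projSqDist_comm]
        exact hfar k hk
      · exact (hL.1 k hk).2 j hj hne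
  obtain ⟨j, hj, hij⟩ := hex
  refine ⟨j, hj, ?_⟩
  have h1 := norm_sub_le_norm_sub_add_norm_sub (WithLp.toLp 2 (o.pts j)) (WithLp.toLp 2 (o.pts i)) μ
  have h2 : ‖WithLp.toLp 2 (o.pts j) - WithLp.toLp 2 (o.pts i)‖ ≤ 12 * Real.sqrt d := by
    refine (abs_le_of_sq_le_sq' ?_ (by positivity)).2
    rw [mul_pow, hs, norm_sub_rev]
    -- Here `4 * 35.2 = 140.8 ≤ 12 ^ 2`.
    nlinarith [hlow i j, Nat.cast_nonneg (α := ℝ) d]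
  linarith [hnorm i hi']

/-! ### Parameters -/

section Parameters

variable {α δ : ℝ}

theorem log_two_le_log_one_div (hα : 0 < α) (hα2 : α ≤ 1 / 2) (hδ : 0 < δ) :
    Real.log (2 / δ) ≤ Real.log (1 / (α * δ)) := by
  refine Real.log_le_log (by positivity) ?_
  rw [div_le_div_iff₀ hδ (by positivity)]
  nlinarith

/-- Used to absorb the rounding errors of `N` and `c` and to trade powers of the logarithm. -/
theorem half_lt_log_two_div (hδ : 0 < δ) (hδ1 : δ < 1) : 1 / 2 < Real.log (2 / δ) := by
  have h1 : Real.log 2 ≤ Real.log (2 / δ) := by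
    refine Real.log_le_log two_pos ?_
    rw [le_div_iff₀ hδ]
    linarith
  linarith [Real.log_two_gt_d9]

theorem sampleSize_pos (hα : 0 < α) (hδ : 0 < δ) (hδ1 : δ < 1) :
    0 < ⌈36 * Real.log (2 / δ) / α⌉₊ := by
  have h : 0 < Real.log (2 / δ) := one_half_pos.trans (half_lt_log_two_div hδ hδ1)
  exact Nat.ceil_pos.2 (by positivity)

theorem sampleSize_le (hα : 0 < α) (hα2 : α ≤ 1 / 2) (hδ : 0 < δ) (hδ1 : δ < 1) :
    (⌈36 * Real.log (2 / δ) / α⌉₊ : ℝ) ≤ 38 * Real.log (1 / (α * δ)) / α := by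
  have h1 := half_lt_log_two_div hδ hδ1
  have h2 := log_two_le_log_one_div hα hα2 hδ
  have h0 : 0 < Real.log (2 / δ) := one_half_pos.trans h1
  have h0' : 0 < Real.log (1 / (α * δ)) := h0.trans_le h2
  have h3 := Nat.ceil_lt_add_one (show 0 ≤ 36 * Real.log (2 / δ) / α by positivity)
  refine h3.le.trans ?_
  rw [div_add_one hα.ne']
  gcongr
  linarith

theorem sketchSize_le (K : ℕ) (hα : 0 < α) (hα2 : α ≤ 1 / 2) (hδ : 0 < δ) (hδ1 : δ < 1) :
    (⌈K * Real.log (1 / (α * δ))⌉₊ : ℝ) ≤ (K + 2) * Real.log (1 / (α * δ)) := by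
  have h1 := half_lt_log_two_div hδ hδ1
  have h2 := log_two_le_log_one_div hα hα2 hδ
  have h0 : 0 < Real.log (2 / δ) := one_half_pos.trans h1
  have h0' : 0 < Real.log (1 / (α * δ)) := h0.trans_le h2
  have h3 := Nat.ceil_lt_add_one (show 0 ≤ K * Real.log (1 / (α * δ)) by positivity)
  linarith

theorem exp_sampleSize_le (hα : 0 < α) (hδ : 0 < δ) :
    Real.exp (-(α * ⌈36 * Real.log (2 / δ) / α⌉₊ / 36)) ≤ δ / 2 := by
  have h1 := Nat.le_ceil (36 * Real.log (2 / δ) / α)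
  rw [div_le_iff₀ hα] at h1
  calc Real.exp (-(α * ⌈36 * Real.log (2 / δ) / α⌉₊ / 36)) ≤ Real.exp (-Real.log (2 / δ)) := by
        gcongr
        linarith
    _ = δ / 2 := by rw [Real.exp_neg, Real.exp_log (by positivity), inv_div]

/-- The union bound over `N ^ 2` pairs. With `u = 1 / (α δ)`, `N` is at most `38 u ^ 2`, while `9000
/ 500 = 18` makes a single failure at most `2 / u ^ 18`. Of the surplus, `1 / u ≤ δ` supplies the
factor `δ`, and `u ≥ 2` makes `2888 / u ^ 13` at most `1 / 2`. -/
theorem sampleSize_sq_mul_exp_sketchSize_le {K : ℕ} (hK : 9000 ≤ K) (hα : 0 < α) (hα2 : α ≤ 1 / 2)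
    (hδ : 0 < δ) (hδ1 : δ < 1) :
    (⌈36 * Real.log (2 / δ) / α⌉₊ : ℝ) ^ 2 *
      (2 * Real.exp (-(⌈K * Real.log (1 / (α * δ))⌉₊ / 500))) ≤ δ / 2 := by
  have hN := sampleSize_le hα hα2 hδ hδ1
  have hl := (half_lt_log_two_div hδ hδ1).trans_le (log_two_le_log_one_div hα hα2 hδ)
  set u := 1 / (α * δ) with hu
  have hu0 : 0 < u := by positivity
  have hαu : 1 / α ≤ u := by
    rw [hu]
    gcongr
    nlinarith
  have hδu : 1 / u ≤ δ := by
    rw [hu, one_div_one_div]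
    nlinarith
  have hu2 : 2 ≤ u := le_trans (by rw [le_div_iff₀ hα]; linarith) hαu
  have hlu : Real.log u ≤ u := (Real.log_le_sub_one_of_pos hu0).trans (by linarith)
  have hN2 : (⌈36 * Real.log (2 / δ) / α⌉₊ : ℝ) ≤ 38 * u ^ 2 := by
    refine hN.trans ?_
    calc 38 * Real.log u / α = 38 * (Real.log u * (1 / α)) := by ring
      _ ≤ 38 * (u * u) := by gcongr
      _ = 38 * u ^ 2 := by ring
  have hexp : Real.exp (-(⌈K * Real.log u⌉₊ / 500)) ≤ 1 / u ^ 18 := by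
    have hK' : (9000 : ℝ) ≤ K := by exact_mod_cast hK
    have h1 := Nat.le_ceil (K * Real.log u)
    calc Real.exp (-(⌈K * Real.log u⌉₊ / 500)) ≤ Real.exp (-((18 : ℕ) * Real.log u)) := by
          gcongr
          push_cast
          nlinarith
      _ = 1 / u ^ 18 := by
          rw [Real.exp_neg, Real.exp_nat_mul, Real.exp_log hu0, one_div]
  calc _ ≤ (38 * u ^ 2) ^ 2 * (2 * (1 / u ^ 18)) := by gcongr
    _ = 2888 / u ^ 13 * (1 / u) := by
        field_simp
        norm_num
    _ ≤ 1 / 2 * δ := by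
        refine mul_le_mul ?_ hδu (by positivity) (by positivity)
        rw [div_le_div_iff₀ (by positivity) two_pos]
        calc (2888 * 2 : ℝ) ≤ 1 * 2 ^ 13 := by norm_num
          _ ≤ 1 * u ^ 13 := by gcongr
    _ = δ / 2 := by ring

theorem costBound_le {C : ℝ} (hC : 0 < C) {K d : ℕ} (hK : 1 ≤ K) (hd : 1 ≤ d) (hα : 0 < α)
    (hα2 : α ≤ 1 / 2) (hαd : α ≤ 1 / (C * d)) (hδ : 0 < δ) (hδ1 : δ < 1) :
    (Prog.costBound d ⌈36 * Real.log (2 / δ) / α⌉₊ ⌈K * Real.log (1 / (α * δ))⌉₊ : ℝ) ≤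
      (100 * (38 ^ 2 * (K + 2)) * 2 + 100 * (38 * (K + 2) / C) * 4) *
        (1 / α ^ 2 * Real.log (1 / (α * δ)) ^ 4) := by
  have hl := (half_lt_log_two_div hδ hδ1).trans_le (log_two_le_log_one_div hα hα2 hδ)
  have hN := sampleSize_le hα hα2 hδ hδ1
  have hN1 := sampleSize_pos hα hδ hδ1
  have hc := sketchSize_le K hα hα2 hδ hδ1
  have hc1 : 0 < ⌈K * Real.log (1 / (α * δ))⌉₊ := by
    have : (0 : ℝ) < K := by exact_mod_cast hK
    exact Nat.ceil_pos.2 (by positivity)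
  generalize ⌈36 * Real.log (2 / δ) / α⌉₊ = N at *
  generalize ⌈K * Real.log (1 / (α * δ))⌉₊ = c at *
  set l := Real.log (1 / (α * δ))
  have hd0 : (0 : ℝ) < d := by exact_mod_cast hd
  have hdα : (d : ℝ) ≤ 1 / (C * α) := by
    rw [le_div_iff₀ (by positivity)] at hαd ⊢
    linarith
  -- As `N`, `c`, `d` are at least `1`, every monomial of the cost is dominated by `N * N * c` or `N
  -- * c * d`.
  have hcost : Prog.costBound d N c ≤ 100 * (N * N * c) + 100 * (N * c * d) := by
    have e1 : 1 * 1 * 1 ≤ N * c * d := by gcongr <;> assumption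
    have e2 : N * 1 * 1 ≤ N * c * d := by gcongr; assumption
    have e3 : N * 1 * d ≤ N * c * d := by gcongr; assumption
    have e4 : 1 * c * d ≤ N * c * d := by gcongr; assumption
    have e5 : 1 * 1 * d ≤ N * c * d := by gcongr <;> assumption
    have e6 : N * c * 1 ≤ N * c * d := by gcongr
    have e7 : N * N * 1 ≤ N * N * c := by gcongr; assumption
    have e8 : 0 ≤ N * N * c := Nat.zero_le _
    rw [Prog.costBound]
    linarith
  have h1 : (N * N * c : ℝ) ≤ 38 ^ 2 * (K + 2) * (1 / α ^ 2 * l ^ 3) := by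
    calc (N * N * c : ℝ) ≤ (38 * l / α) * (38 * l / α) * ((K + 2) * l) := by gcongr
      _ = 38 ^ 2 * (K + 2) * (1 / α ^ 2 * l ^ 3) := by ring
  have h2 : (N * c * d : ℝ) ≤ 38 * (K + 2) / C * (1 / α ^ 2 * l ^ 2) := by
    calc (N * c * d : ℝ) ≤ (38 * l / α) * ((K + 2) * l) * (1 / (C * α)) := by gcongr
      _ = 38 * (K + 2) / C * (1 / α ^ 2 * l ^ 2) := by field_simp
  -- Each missing power of `l` costs a factor `2`, because `l > 1 / 2`.
  have h3 : l ^ 3 ≤ 2 * l ^ 4 := by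
    have : 0 ≤ l ^ 3 := by positivity
    nlinarith
  have h4 : l ^ 2 ≤ 4 * l ^ 4 := by
    have : 1 ≤ 4 * l ^ 2 := by nlinarith
    nlinarith [sq_nonneg l]
  calc (Prog.costBound d N c : ℝ) ≤ 100 * (N * N * c) + 100 * (N * c * d) := by
        exact_mod_cast hcost
    _ ≤ 100 * (38 ^ 2 * (K + 2) * (1 / α ^ 2 * (2 * l ^ 4))) +
        100 * (38 * (K + 2) / C * (1 / α ^ 2 * (4 * l ^ 4))) := by
        refine add_le_add (mul_le_mul_of_nonneg_left (h1.trans ?_) (by norm_num))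
          (mul_le_mul_of_nonneg_left (h2.trans ?_) (by norm_num)) <;> gcongr
    _ = _ := by ring

end Parameters

/-! ### The success probability -/

/-- Peels off one layer of randomness by discarding its bad outcomes. Applied to the sample and
then, inside, to the matrix, it multiplies the two success probabilities. -/
theorem ofReal_mul_le_average {Ω : Type} [Fintype Ω] [Nonempty Ω] (P : Ω → Prop) [DecidablePred P]
    {f : Ω → ENNReal} {c : ENNReal} {ε : ℝ} (hP : (#{ω | ¬ P ω} : ℝ) ≤ ε * Fintype.card Ω)
    (hf : ∀ ω, P ω → c ≤ f ω) :
    ENNReal.ofReal (1 - ε) * c ≤ (Fintype.card Ω : ENNReal)⁻¹ * ∑ ω, f ω := by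
  have hcard : (0 : ℝ) < Fintype.card Ω := by exact_mod_cast Fintype.card_pos
  have h1 : ENNReal.ofReal (1 - ε) * Fintype.card Ω ≤ #{ω | P ω} := by
    rw [← ENNReal.ofReal_natCast, ← ENNReal.ofReal_mul' hcard.le, ← ENNReal.ofReal_natCast]
    refine ENNReal.ofReal_le_ofReal ?_
    have : (#{ω | P ω} : ℝ) + #{ω | ¬ P ω} = Fintype.card Ω := by
      exact_mod_cast card_filter_add_card_filter_not (s := univ) P
    linarith
  have h2 : #{ω | P ω} * c ≤ ∑ ω, f ω := by
    calc #{ω | P ω} * c = ∑ ω with P ω, c := by simp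
      _ ≤ ∑ ω with P ω, f ω := sum_le_sum fun ω hω => hf ω (mem_filter.1 hω).2
      _ ≤ ∑ ω, f ω := sum_le_sum_of_subset (filter_subset _ _)
  calc ENNReal.ofReal (1 - ε) * c
      = (Fintype.card Ω : ENNReal)⁻¹ * (ENNReal.ofReal (1 - ε) * Fintype.card Ω * c) := by
        rw [mul_right_comm, mul_comm _ (Fintype.card Ω : ENNReal), ← mul_assoc,
          ENNReal.inv_mul_cancel (by simp) (by simp), one_mul]
    _ ≤ (Fintype.card Ω : ENNReal)⁻¹ * (#{ω | P ω} * c) := by gcongr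
    _ ≤ _ := by gcongr

open Classical in
theorem card_exists_isDistorted_le {d c N : ℕ} (hc : 0 < c) (x : Fin N → Fin d → ℝ) :
    (#{b : Fin d → Fin c → Bool | ¬ ∀ i j, ¬ IsDistorted (x i - x j) b} : ℝ) ≤
      N ^ 2 * (2 * Real.exp (-(c / 500))) * Fintype.card (Fin d → Fin c → Bool) := by
  have hsub : (univ.filter fun b : Fin d → Fin c → Bool => ¬ ∀ i j, ¬ IsDistorted (x i - x j) b) ⊆
      (univ : Finset (Fin N × Fin N)).biUnion fun p =>
        univ.filter fun b => IsDistorted (x p.1 - x p.2) b := by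
    intro b hb
    simpa using hb
  calc _ ≤ (∑ p : Fin N × Fin N,
          #{b : Fin d → Fin c → Bool | IsDistorted (x p.1 - x p.2) b} : ℝ) := by
        exact_mod_cast (card_le_card hsub).trans card_biUnion_le
    _ ≤ ∑ _p : Fin N × Fin N,
          2 * Real.exp (-(c / 500)) * Fintype.card (Fin d → Fin c → Bool) :=
        sum_le_sum fun p _ => card_isDistorted_le hc _
    _ = _ := by
        rw [sum_const, card_univ, Fintype.card_prod, Fintype.card_fin, nsmul_eq_mul]
        push_cast
        ring

theorem ofReal_le_toOuterMeasure_samplePostProcess {d n : ℕ} [NeZero n] (hd : 1 ≤ d)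
    {X : Fin n → EuclideanSpace ℝ (Fin d)} {μ : EuclideanSpace ℝ (Fin d)} {α δ : ℝ} {K : ℕ}
    (hK : 9000 ≤ K) (hα : 0 < α) (hα2 : α ≤ 1 / 2) (hδ : 0 < δ) (hδ1 : δ < 1)
    (hX : HasInliers X α μ) :
    ENNReal.ofReal (1 - δ) ≤ ((samplePostProcess K α δ).exec X).toOuterMeasure
      {o | o.1 ∈ {o : Outcome ℝ d | ∀ L, Maximal (o.IsClusterSet α) L →
        ∃ i ∈ L, ‖WithLp.toLp 2 (o.pts i) - μ‖ ≤ 14 * Real.sqrt d}} := by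
  classical
  have hN0 := sampleSize_pos hα hδ hδ1
  have hexpN := exp_sampleSize_le hα hδ
  have hpair := sampleSize_sq_mul_exp_sketchSize_le hK hα hα2 hδ hδ1
  have hc0 : 0 < ⌈K * Real.log (1 / (α * δ))⌉₊ := by
    have := (half_lt_log_two_div hδ hδ1).trans_le (log_two_le_log_one_div hα hα2 hδ)
    have : (0 : ℝ) < K := by exact_mod_cast (show 0 < K by omega)
    exact Nat.ceil_pos.2 (by positivity)
  rw [Prog.toOuterMeasure_exec, Prog.expect_samplePostProcess K α δ rfl rfl]
  generalize ⌈36 * Real.log (2 / δ) / α⌉₊ = N at *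
  generalize ⌈K * Real.log (1 / (α * δ))⌉₊ = c at *
  have hnear : α / 2 * Fintype.card (Fin n) ≤ #{i | ‖X i - μ‖ ^ 2 ≤ 2 * d} := by
    rw [Fintype.card_fin]
    exact hX.card_near_ge hα (NeZero.pos n) hd
  have hfew := card_few_successes_le (fun i => ‖X i - μ‖ ^ 2 ≤ 2 * d) hα.le hnear N
  -- Two layers with failure probability `δ / 2` each: `(1 - δ / 2) ^ 2 ≥ 1 - δ`.
  have hδ2 : ENNReal.ofReal (1 - δ) ≤
      ENNReal.ofReal (1 - δ / 2) * (ENNReal.ofReal (1 - δ / 2) * 1) := by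
    rw [mul_one, ← ENNReal.ofReal_mul (by linarith)]
    exact ENNReal.ofReal_le_ofReal (by nlinarith [sq_nonneg δ])
  refine hδ2.trans (ofReal_mul_le_average
    (fun ι : Fin N → Fin n => α * N / 3 ≤ (#{i | ‖X (ι i) - μ‖ ^ 2 ≤ 2 * d} : ℝ)) ?_
    fun ι hι => ofReal_mul_le_average
      (fun b : Fin d → Fin c → Bool =>
        ∀ i j, ¬ IsDistorted ((X (ι i)).ofLp - (X (ι j)).ofLp) b) ?_ fun b hb => ?_)
  · simp only [not_le]
    refine hfew.trans ?_
    gcongr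
  · refine (card_exists_isDistorted_le hc0 fun i => (X (ι i)).ofLp).trans ?_
    gcongr
  -- The event does not depend on the selection, so the indicator is `1` whatever `clusterPhase`
  -- selects.
  · refine le_of_eq ((Prog.ensures_clusterPhase α N c _ _).expect_eq ?_).symm
    rintro o ⟨sel, rfl, -⟩
    refine Set.indicator_of_mem ?_ _
    refine fun L hL => Outcome.exists_norm_sub_le
      (o := ⟨N, c, fun i => (X (ι i)).ofLp, boolMatrix b, sel⟩) hα hN0 hι ?_ ?_ hL
    · intro i j
      have := not_lt.1 (not_or.1 (hb i j)).1
      simpa [Outcome.projSqDist, EuclideanSpace.real_norm_sq_eq] using this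
    · intro i j
      have := not_lt.1 (not_or.1 (hb i j)).2
      simpa [Outcome.projSqDist, EuclideanSpace.real_norm_sq_eq] using this

end

theorem propositionA1 :
    ∃ K₀ : ℕ, ∀ C : ℝ, 0 < C → ∃ A : ℝ, 0 < A ∧ ∀ K : ℕ, K₀ ≤ K → ∃ B : ℝ, 0 < B ∧
      ∀ (d n : ℕ) [NeZero n], 1 ≤ d →
      ∀ (X : Fin n → EuclideanSpace ℝ (Fin d)) (μ : EuclideanSpace ℝ (Fin d)) (α δ : ℝ),
        0 < α → α ≤ 1 / 2 → α ≤ 1 / (C * d) → 0 < δ → δ < 1 → HasInliers X α μ →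
        -- in every execution: a maximal set is returned, maximal sets are small, the time is bounded
        (∀ o ∈ ((samplePostProcess K α δ).exec X).support,
          Maximal (o.1.IsClusterSet α) o.1.returned ∧
          (∀ L, Maximal (o.1.IsClusterSet α) L → (L.card : ℝ) ≤ 3 / α) ∧
          (o.2 : ℝ) ≤ B * (1 / α ^ 2 * Real.log (1 / (α * δ)) ^ 4)) ∧
        -- with probability at least `1 - δ`, every maximal set has a point close to `μ`
        ENNReal.ofReal (1 - δ) ≤ ((samplePostProcess K α δ).exec X).toOuterMeasure
          {o | ∀ L, Maximal (o.1.IsClusterSet α) L →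
            ∃ i ∈ L, ‖WithLp.toLp 2 (o.1.pts i) - μ‖ ≤ A / Real.sqrt α} := by
  refine ⟨9000, fun C hC => ⟨14 / Real.sqrt C, by positivity, fun K hK =>
    ⟨100 * (38 ^ 2 * (K + 2)) * 2 + 100 * (38 * (K + 2) / C) * 4, by positivity, ?_⟩⟩⟩
  intro d n _ hd X μ α δ hα hα2 hαd hδ hδ1 hX
  refine ⟨fun o ho => ?_, ?_⟩
  · obtain ⟨⟨hN, hsel⟩, hT⟩ := Prog.ensures_samplePostProcess K α δ o ho
    refine ⟨Outcome.maximal_returned hsel, fun L hL =>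
      Outcome.card_le_of_isClusterSet hα (hN ▸ sampleSize_pos hα hδ hδ1) hL.1, ?_⟩
    exact le_trans (by exact_mod_cast hT) (costBound_le hC (by omega) hd hα hα2 hαd hδ hδ1)
  · refine (ofReal_le_toOuterMeasure_samplePostProcess hd hK hα hα2 hδ hδ1 hX).trans
      (MeasureTheory.measure_mono fun o ho L hL => ?_)
    obtain ⟨i, hi, hle⟩ := ho L hL
    refine ⟨i, hi, hle.trans ?_⟩
    have hd0 : (0 : ℝ) < d := by exact_mod_cast hd
    -- The claim `14 √d ≤ 14 / √(C α)` is equivalent to `d C α ≤ 1`.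
    rw [div_div, ← Real.sqrt_mul hC.le, le_div_iff₀ (by positivity), mul_assoc,
      ← Real.sqrt_mul hd0.le]
    have : Real.sqrt (d * (C * α)) ≤ 1 := by
      rw [Real.sqrt_le_one]
      rw [le_div_iff₀ (by positivity)] at hαd
      linarith
    linarith
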